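/- Let $N,d\ge 1$ and write $x=(x_1,\dots,x_N)\in\mathbb{R}^{Nd}\cong(\mathbb{R}^d)^N$; for $C\in\mathbb{R}^{Nd\times Nd}$ let $C_{s,t}\in\mathbb{R}^{d\times d}$ denote its $(s,t)$-th block. *Filtered processes.* A filtered process $\mathbb{X}$ consists of a probability space $(\Omega^{\mathbb X},\mathcal F^{\mathbb X},\mathbb P^{\mathbb X})$ with a filtration $(\mathcal F_t^{\mathbb X})_{t=1}^N$ and an $\mathbb{R}^d$-valued adapted process $X=(X_t)_{t=1}^N$. A coupling $\pi$ of $\mathbb P^{\mathbb X}$ and $\mathbb P^{\mathbb Y}$ on $\Omega^{\mathbb X}\times\Omega^{\mathbb Y}$ is bicausal if for every $1\le t\le N$, under $\pi$, $\mathcal F^{\mathbb X}_N\otimes\{\emptyset,\Omega^{\mathbb Y}\}$ is conditionally independent of $\{\emptyset,\Omega^{\mathbb X}\}\otimes\mathcal F_t^{\mathbb Y}$ given $\mathcal F_t^{\mathbb X}\otimes\{\emptyset,\Omega^{\mathbb Y}\}$, and the same holds with the roles of $\mathbb X$ and $\mathbb Y$ exchanged. The adapted $2$-Wasserstein distance is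 $$\mathcal{AW}_2(\mathbb X,\mathbb Y)=\inf_{\pi\text{ bicausal}}\mathbb E_\pi\big[\|X-Y\|_2^2\big]^{1/2}.$$ The canonical representation $\mathbb X^\mu$ of a law $\mu$ on $\mathbb R^{Nd}$ is the coordinate process on $(\mathbb R^{Nd},\mathcal B(\mathbb R^{Nd}),\mu)$ with its natural filtration, and $\mathcal{AW}_2(\mu,\nu):=\mathcal{AW}_2(\mathbb X^\mu,\mathbb X^\nu)$. For $a\in\mathbb R^{Nd}$ and a block lower triangular $L\in\mathbb R^{Nd\times Nd}$ (that is, $L_{t,s}=0$ for $s>t$), $\mathbb G^{a,L}$ is the process $X=a+L\epsilon$, where $\epsilon$ is the coordinate process on $\mathbb R^{Nd}$ under $\mathcal N(0,I)$, equipped with the natural filtration of $\epsilon$. *Cholesky factors.* For $A\in\mathbb R^{n\times n}$ symmetric positive semidefinite, the minimal Cholesky factor $\mathcal C_{\min}(A)$ is the unique lower triangular $L\in\mathbb R^{n\times n}$ with nonnegative diagonal entries such that $LL^{\intercal}=A$ and, whenever $L_{[i,i]}=0$, the whole $i$-th column of $L$ vanishes. For block lower triangular $L,M\in\mathbb R^{Nd\times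 Nd}$ let $$\mathsf{dist}_{\mathrm{AW}}(L,M)=\Big(\|L\|_{\mathrm F}^2+\|M\|_{\mathrm F}^2-2\sum_{t=1}^N\|(L^{\intercal}M)_{t,t}\|_*\Big)^{1/2},$$ where $\|\cdot\|_{\mathrm F}$ is the Frobenius norm and $\|C\|_*=\operatorname{tr}\big((C^{\intercal}C)^{1/2}\big)$ is the nuclear norm. **Theorem.** (i) For every $a\in\mathbb R^{Nd}$ and every positive semidefinite, possibly singular, $A\in\mathbb R^{Nd\times Nd}$, the Gaussian law $\mu=\mathcal N(a,A)$ satisfies $$\mathcal{AW}_2\big(\mathbb G^{a,\mathcal C_{\min}(A)},\mathbb X^\mu\big)=0.$$ (ii) For all $a,b\in\mathbb R^{Nd}$ and all positive semidefinite, possibly singular, $A,B\in\mathbb R^{Nd\times Nd}$, $$\mathcal{AW}_2^2\big(\mathcal N(a,A),\mathcal N(b,B)\big)=\|a-b\|_2^2+\mathsf{dist}_{\mathrm{AW}}^2\big(\mathcal C_{\min}(A),\mathcal C_{\min}(B)\big).$$ -/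

import Mathlib

open MeasureTheory ProbabilityTheory Matrix
open scoped ENNReal MatrixOrder

namespace AdaptedGaussian

noncomputable section

/-! ### The minimal Cholesky factor -/

/-- `L` is a minimal Cholesky factor of `A`: `L` is lower triangular with nonnegative diagonal
entries, `L Lᵀ = A`, and a column of `L` vanishes as soon as its diagonal entry does. -/
structure IsMinCholesky {n : Type*} [Fintype n] [LinearOrder n] (A L : Matrix n n ℝ) : Prop where
  lower : ∀ i j, i < j → L i j = 0
  diag_nonneg : ∀ i, 0 ≤ L i i
  mul_transpose : L * Lᵀ = A
  column_zero : ∀ i, L i i = 0 → ∀ j, i ≤ j → L j i = 0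

theorem IsMinCholesky.unique {n : Type*} [Fintype n] [LinearOrder n] {A L M : Matrix n n ℝ}
    (hL : IsMinCholesky A L) (hM : IsMinCholesky A M) : L = M := by
  suffices h : ∀ j, ∀ i, L i j = M i j from Matrix.ext fun i j => h j i
  intro j
  induction j using WellFoundedLT.induction with
  | ind j ih =>
    have split : ∀ (K : Matrix n n ℝ), (∀ i j, i < j → K i j = 0) → ∀ i,
        (K * Kᵀ) i j = ∑ k with k < j, K i k * K j k + K i j * K j j := by
      intro K hK i
      rw [Matrix.mul_apply, ← Finset.sum_filter_add_sum_filter_not _ (fun k => k < j)]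
      congr 1
      rw [Finset.sum_eq_single j]
      · rfl
      · intro k hk hkj
        have : j < k := lt_of_le_of_ne (by simpa using hk) (Ne.symm hkj)
        simp [hK j k this]
      · simp
    have key : ∀ i, L i j * L j j = M i j * M j j := by
      intro i
      have h1 := split L hL.lower i
      have h2 := split M hM.lower i
      rw [hL.mul_transpose] at h1
      rw [hM.mul_transpose] at h2
      have h3 : ∑ k with k < j, L i k * L j k = ∑ k with k < j, M i k * M j k := by
        refine Finset.sum_congr rfl fun k hk => ?_
        have hk' : k < j := by simpa using hk
        rw [ih k hk' i, ih k hk' j]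
      linarith
    have hd : L j j = M j j := by
      have := key j
      exact (mul_self_inj (hL.diag_nonneg j) (hM.diag_nonneg j)).1 this
    intro i
    by_cases h0 : L j j = 0
    · rcases lt_or_ge i j with hij | hij
      · rw [hL.lower i j hij, hM.lower i j hij]
      · rw [hL.column_zero j h0 i hij, hM.column_zero j (hd ▸ h0) i hij]
    · have := key i
      rw [← hd] at this
      exact mul_right_cancel₀ h0 this

theorem exists_isMinCholesky {n : Type*} [Fintype n] [LinearOrder n] {A : Matrix n n ℝ}
    (hA : A.PosSemidef) : ∃ L, IsMinCholesky A L := by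
  let _ : LocallyFiniteOrderBot n :=
    LocallyFiniteOrderBot.ofIic n (fun a => Finset.univ.filter (· ≤ a)) (by simp)
  obtain ⟨B, hB⟩ : ∃ B : Matrix n n ℝ, A = Bᴴ * B := by
    refine ⟨CFC.sqrt A, ?_⟩
    have h1 : (CFC.sqrt A)ᴴ = CFC.sqrt A := (CFC.sqrt_nonneg A).isSelfAdjoint
    rw [h1, CFC.sqrt_mul_sqrt_self A hA.nonneg]
  let v : n → EuclideanSpace ℝ n := fun i => WithLp.toLp 2 fun k => B k i
  have hv : ∀ i k, inner ℝ (v i) (v k) = A i k := by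
    intro i k
    rw [hB, Matrix.mul_apply]
    simp [v, PiLp.inner_apply, mul_comm]
  have hdim : Module.finrank ℝ (EuclideanSpace ℝ n) = Fintype.card n := by simp
  let b := InnerProductSpace.gramSchmidtOrthonormalBasis hdim v
  have hdiag : ∀ i, InnerProductSpace.gramSchmidtNormed ℝ v i ≠ 0 →
      inner ℝ (b i) (v i) = ‖InnerProductSpace.gramSchmidt ℝ v i‖ ∧
        0 < ‖InnerProductSpace.gramSchmidt ℝ v i‖ := by
    intro i hi
    have hg : InnerProductSpace.gramSchmidt ℝ v i ≠ 0 := by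
      intro h
      exact hi (by simp [InnerProductSpace.gramSchmidtNormed, h])
    refine ⟨?_, norm_pos_iff.2 hg⟩
    have h1 : inner ℝ (InnerProductSpace.gramSchmidt ℝ v i) (v i)
        = ‖InnerProductSpace.gramSchmidt ℝ v i‖ ^ 2 := by
      conv_lhs => rw [InnerProductSpace.gramSchmidt_def'' ℝ v i]
      rw [inner_add_right, inner_sum, Finset.sum_eq_zero, add_zero, real_inner_self_eq_norm_sq]
      intro k hk
      rw [inner_smul_right, InnerProductSpace.gramSchmidt_orthogonal ℝ v
        (Finset.mem_Iio.1 hk).ne', mul_zero]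
    change inner ℝ (InnerProductSpace.gramSchmidtOrthonormalBasis hdim v i) (v i) = _
    rw [InnerProductSpace.gramSchmidtOrthonormalBasis_apply hdim hi,
      InnerProductSpace.gramSchmidtNormed, inner_smul_left, h1]
    have := norm_ne_zero_iff.2 hg
    simp
    field_simp
  refine ⟨Matrix.of fun i j => inner ℝ (b j) (v i), ⟨?_, ?_, ?_, ?_⟩⟩
  · intro i j hij
    exact InnerProductSpace.gramSchmidtOrthonormalBasis_inv_triangular hdim v hij
  · intro i
    by_cases hi : InnerProductSpace.gramSchmidtNormed ℝ v i = 0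
    · exact (InnerProductSpace.inner_gramSchmidtOrthonormalBasis_eq_zero hdim hi i).ge
    · have := hdiag i hi
      simp only [Matrix.of_apply]
      linarith
  · ext i k
    rw [← hv, Matrix.mul_apply, ← b.sum_inner_mul_inner]
    refine Finset.sum_congr rfl fun j _ => ?_
    simp [real_inner_comm]
  · intro i hi j _
    by_cases h : InnerProductSpace.gramSchmidtNormed ℝ v i = 0
    · exact InnerProductSpace.inner_gramSchmidtOrthonormalBasis_eq_zero hdim h j
    · have h1 := hdiag i h
      simp only [Matrix.of_apply] at hi
      linarith

/-- The minimal Cholesky factor of a positive semidefinite matrix, that is, the unique matrix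
which satisfies `IsMinCholesky A`. -/
def minCholesky {n : Type*} [Fintype n] [LinearOrder n] (A : Matrix n n ℝ)
    (hA : A.PosSemidef) : Matrix n n ℝ :=
  (exists_isMinCholesky hA).choose

theorem isMinCholesky_minCholesky {n : Type*} [Fintype n] [LinearOrder n] {A : Matrix n n ℝ}
    (hA : A.PosSemidef) : IsMinCholesky A (minCholesky A hA) :=
  (exists_isMinCholesky hA).choose_spec

/-! ### PathSpace space -/

/-- The scalar indices of a vector in `ℝ^{Nd}`, ordered lexicographically: first by the time step
`t`, then by the spatial coordinate. -/
abbrev Idx (N d : ℕ) : Type := Fin N ×ₗ Fin d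

/-- The path space `ℝ^{Nd} ≅ (ℝ^d)^N` with its Euclidean norm. -/
abbrev PathSpace (N d : ℕ) : Type := EuclideanSpace ℝ (Idx N d)

/-- The `t`-th temporal block `x_t ∈ ℝ^d` of a path `x ∈ ℝ^{Nd}`. -/
def block {N d : ℕ} (t : Fin N) (x : PathSpace N d) : EuclideanSpace ℝ (Fin d) :=
  WithLp.toLp 2 fun i => x (toLex (t, i))

theorem measurable_block {N d : ℕ} (t : Fin N) : Measurable (block (d := d) t) := by
  unfold block
  fun_prop

/-- The `(s, t)`-th temporal block of an `Nd × Nd` matrix. -/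
def matBlock {N d : ℕ} (C : Matrix (Idx N d) (Idx N d) ℝ) (s t : Fin N) :
    Matrix (Fin d) (Fin d) ℝ :=
  Matrix.of fun i j => C (toLex (s, i)) (toLex (t, j))

/-- Block lower triangular matrices: the `(t, s)`-th block vanishes whenever `s > t`. -/
def IsBlockLower {N d : ℕ} (L : Matrix (Idx N d) (Idx N d) ℝ) : Prop :=
  ∀ s t : Fin N, t < s → matBlock L t s = 0

theorem isBlockLower_minCholesky {N d : ℕ} {A : Matrix (Idx N d) (Idx N d) ℝ}
    (hA : A.PosSemidef) : IsBlockLower (minCholesky A hA) := by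
  intro s t hts
  ext i j
  exact (isMinCholesky_minCholesky hA).lower _ _ (Prod.Lex.toLex_lt_toLex.2 (Or.inl hts))

/-! ### Filtered processes and the adapted 2-Wasserstein distance -/

/-- A filtered process: a filtered probability space, with time steps `t ∈ Fin N`, and an
`ℝ^d`-valued process adapted to the filtration. -/
structure FilteredProcess (N d : ℕ) where
  Ω : Type*
  mΩ : MeasurableSpace Ω
  P : Measure Ω
  isProb : IsProbabilityMeasure P
  F : Filtration (Fin N) mΩ
  X : Fin N → Ω → EuclideanSpace ℝ (Fin d)
  adapted : Adapted F X

attribute [instance] FilteredProcess.mΩ FilteredProcess.isProb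

/-- The filtration on path space generated by the coordinate process `x ↦ (x_1, …, x_N)`. -/
def pathFiltration (N d : ℕ) : Filtration (Fin N) (inferInstance : MeasurableSpace (PathSpace N d)) :=
  Filtration.natural (fun t => block t) fun t => (measurable_block t).stronglyMeasurable

theorem measurable_block_pathFiltration {N d : ℕ} {s t : Fin N} (hst : s ≤ t) :
    Measurable[pathFiltration N d t] (block (d := d) s) := by
  have h : Measurable[pathFiltration N d s] (block (d := d) s) :=
    (Filtration.stronglyAdapted_natural
      fun t => (measurable_block (d := d) t).stronglyMeasurable).adapted s
  exact h.mono ((pathFiltration N d).mono hst) le_rfl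

/-- The canonical representation of a law `μ` on path space: the coordinate process under `μ`,
with its natural filtration. -/
def canonical {N d : ℕ} (μ : Measure (PathSpace N d)) [IsProbabilityMeasure μ] :
    FilteredProcess N d where
  Ω := PathSpace N d
  mΩ := inferInstance
  P := μ
  isProb := inferInstance
  F := pathFiltration N d
  X := fun t => block t
  adapted := fun _ => measurable_block_pathFiltration le_rfl

/-- The filtered Gaussian process `X = a + L ε`, where `ε` is the coordinate process on path
space under the standard Gaussian measure `N(0, I)`, equipped with the filtration of `ε`. -/
def gaussianProcess {N d : ℕ} (a : PathSpace N d) (L : Matrix (Idx N d) (Idx N d) ℝ)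
    (hL : IsBlockLower L) : FilteredProcess N d where
  Ω := PathSpace N d
  mΩ := inferInstance
  P := stdGaussian (PathSpace N d)
  isProb := inferInstance
  F := pathFiltration N d
  X := fun t ε => block t (a + WithLp.toLp 2 (L *ᵥ ε.ofLp))
  adapted := by
    intro t
    have hX : ∀ i : Fin d, Measurable[pathFiltration N d t]
        fun ε : PathSpace N d => (block t (a + WithLp.toLp 2 (L *ᵥ ε.ofLp))) i := by
      intro i
      have hterm : ∀ k : Idx N d, Measurable[pathFiltration N d t]
          fun ε : PathSpace N d => L (toLex (t, i)) k * ε k := by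
        intro k
        by_cases hk : (ofLex k).1 ≤ t
        · exact (((PiLp.continuous_apply 2 _ (ofLex k).2).measurable.comp
            (measurable_block_pathFiltration hk)).const_mul _)
        · have h0 : L (toLex (t, i)) k = 0 :=
            congrFun (congrFun (hL (ofLex k).1 t (not_le.1 hk)) i) (ofLex k).2
          simp only [h0, zero_mul]
          exact measurable_const
      have hsum : Measurable[pathFiltration N d t]
          fun ε : PathSpace N d => ∑ k, L (toLex (t, i)) k * ε k :=
        @Finset.measurable_fun_sum ℝ _ _ _ _ _ (pathFiltration N d t) _ Finset.univ
          fun k _ => hterm k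
      exact @Measurable.comp _ _ _ (pathFiltration N d t) _ _ _ _
        (measurable_const_add (a (toLex (t, i)))) hsum
    have hpi : Measurable[pathFiltration N d t] fun ε : PathSpace N d =>
        (block t (a + WithLp.toLp 2 (L *ᵥ ε.ofLp))).ofLp :=
      @measurable_pi_iff _ _ _ (pathFiltration N d t) _ _ |>.2 hX
    exact @Measurable.comp _ _ _ (pathFiltration N d t) _ _ _ _
      (WithLp.measurable_toLp 2 (Fin d → ℝ)) hpi

/-- Under `π`, the σ-algebras `m₁` and `m₂` are conditionally independent given `m`.
(No regularity of the underlying measurable space is needed.) -/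
def CondIndepGiven {Ω : Type*} [mΩ : MeasurableSpace Ω] (π : Measure Ω)
    (m₁ m₂ m : MeasurableSpace Ω) : Prop :=
  ∀ s₁ s₂ : Set Ω, MeasurableSet[m₁] s₁ → MeasurableSet[m₂] s₂ →
    π⟦s₁ ∩ s₂ | m⟧ =ᵐ[π] π⟦s₁ | m⟧ * π⟦s₂ | m⟧

/-- Bicausal couplings of two filtered processes. The supremum `⨆ s, F s` is the terminal
σ-algebra `F_N`, and `⊥` is the trivial σ-algebra `F_0`. -/
structure IsBicausal {N d : ℕ} (𝕏 𝕐 : FilteredProcess N d) (π : Measure (𝕏.Ω × 𝕐.Ω)) :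
    Prop where
  map_fst : π.map Prod.fst = 𝕏.P
  map_snd : π.map Prod.snd = 𝕐.P
  causal : ∀ t : Fin N, CondIndepGiven π
    (MeasurableSpace.prod (⨆ s, 𝕏.F s) ⊥) (MeasurableSpace.prod ⊥ (𝕐.F t))
    (MeasurableSpace.prod (𝕏.F t) ⊥)
  anticausal : ∀ t : Fin N, CondIndepGiven π
    (MeasurableSpace.prod ⊥ (⨆ s, 𝕐.F s)) (MeasurableSpace.prod (𝕏.F t) ⊥)
    (MeasurableSpace.prod ⊥ (𝕐.F t))

/-- The adapted 2-Wasserstein distance `inf_π E_π[‖X - Y‖²]^{1/2}` between filtered processes,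
the infimum being over bicausal couplings; here `‖X - Y‖² = ∑ t, ‖X_t - Y_t‖²`. -/
def AW2 {N d : ℕ} (𝕏 𝕐 : FilteredProcess N d) : ℝ≥0∞ :=
  ⨅ (π : Measure (𝕏.Ω × 𝕐.Ω)) (_ : IsBicausal 𝕏 𝕐 π),
    (∫⁻ z, ∑ t, ‖𝕏.X t z.1 - 𝕐.X t z.2‖ₑ ^ 2 ∂π) ^ (1 / 2 : ℝ)

/-- The adapted 2-Wasserstein distance between laws on path space. -/
def AW2Law {N d : ℕ} (μ ν : Measure (PathSpace N d)) [IsProbabilityMeasure μ]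
    [IsProbabilityMeasure ν] : ℝ≥0∞ :=
  AW2 (canonical μ) (canonical ν)

/-! ### The distance between Cholesky factors -/

/-- The nuclear norm `tr ((Cᵀ C)^{1/2})`. -/
def nuclearNorm {n : Type*} [Fintype n] [DecidableEq n] (C : Matrix n n ℝ) : ℝ :=
  (CFC.sqrt (Cᵀ * C)).trace

section

open scoped Matrix.Norms.Frobenius

/-- The pseudo-metric
`(‖L‖_F² + ‖M‖_F² - 2 ∑ t, ‖(Lᵀ M)_{t,t}‖_*)^{1/2}`, with `‖·‖` the Frobenius norm. -/
def distAW {N d : ℕ} (L M : Matrix (Idx N d) (Idx N d) ℝ) : ℝ :=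
  √(‖L‖ ^ 2 + ‖M‖ ^ 2 - 2 * ∑ t : Fin N, nuclearNorm (matBlock (Lᵀ * M) t t))

end

end

end AdaptedGaussian

open AdaptedGaussian

/-!
A minimal Cholesky factor `L` of `A` is a block lower triangular factor whose noise can be read off
the process, up to the noise coordinates that do not matter. Indeed
(`IsMinCholesky.exists_lower_inverse`) there is an invertible lower triangular matrix `R` such that
`R L = diag δ` with `δ` valued in `{0, 1}`, and `L diag δ = L`. Hence `X = a + L ε` generates the
same filtration as its innovations `R (X - a)`, which are almost surely equal to `δ ε`: a centred
vector with uncorrelated coordinates of variance at most one, whose blocks after time `t` are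
independent of `X` up to time `t`.

*Couplings.* Let `U` be block diagonal and drive `X = a + L ε` and `Y = b + M Uᵀ ε` by the same
noise. The innovations of `X` after time `t` only involve the noise after time `t`, so that they are
independent of both `X` and `Y` up to time `t`, and together with `X` up to time `t` they determine
`X`. By `condIndepGiven_of_indep_sup` the path of `X` is therefore conditionally independent of `Y`
up to time `t` given `X` up to time `t`; the situation is symmetric, and the coupling is bicausal
(`isBicausal_canonical_of_linear`). With the first process equal to the noise itself and `U = 1`,
this couples `𝔾^{a, L}` with the canonical process at no cost. With `U` made of the orthogonal
factors of a singular value decomposition of the diagonal blocks of `Lᵀ M`, the cost is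
`‖a - b‖² + ‖L‖² + ‖M‖² - 2 ∑ t, ‖(Lᵀ M)_{t,t}‖_*` (`exists_isBicausal_lintegral_eq`).

*Optimality.* Under an arbitrary bicausal coupling, let `ξ`, `η` be the innovations of the two
processes. For `t < s`, causality and the independence of `ξ_s` from the first process up to time
`t` give `E[ξ_s η_tᵀ] = 0` (`integral_innovation_mul_eq_zero`), and symmetrically for `s < t`. So the
cross-covariance `K` of `ξ` and `η` is block diagonal, and its blocks are contractions since the
covariances of `ξ` and `η` are at most the identity. The cost is
`‖a - b‖² + ‖L‖² + ‖M‖² - 2 tr ((Lᵀ M)ᵀ K)`, and duality between the nuclear and the operator norm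
bounds it below by the same quantity (`le_lintegral_of_isBicausal`).
-/

/-! ### Conditional independence -/

theorem isPiSystem_inter_of_measurableSpaces {Ω : Type*} (m h : MeasurableSpace Ω) :
    IsPiSystem {s | ∃ a b, MeasurableSet[m] a ∧ MeasurableSet[h] b ∧ s = a ∩ b} := by
  rintro _ ⟨a, b, ha, hb, rfl⟩ _ ⟨a', b', ha', hb', rfl⟩ -
  exact ⟨a ∩ a', b ∩ b', ha.inter ha', hb.inter hb', Set.inter_inter_inter_comm a b a' b'⟩

theorem sup_eq_generateFrom_inter {Ω : Type*} (m h : MeasurableSpace Ω) :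
    m ⊔ h = MeasurableSpace.generateFrom
      {s | ∃ a b, MeasurableSet[m] a ∧ MeasurableSet[h] b ∧ s = a ∩ b} := by
  apply le_antisymm
  · refine sup_le (fun s hs => ?_) (fun s hs => ?_)
    · exact MeasurableSpace.measurableSet_generateFrom
        ⟨s, Set.univ, hs, @MeasurableSet.univ _ h, by simp⟩
    · exact MeasurableSpace.measurableSet_generateFrom
        ⟨Set.univ, s, @MeasurableSet.univ _ m, hs, by simp⟩
  · refine MeasurableSpace.generateFrom_le ?_
    rintro _ ⟨a, b, ha, hb, rfl⟩
    exact MeasurableSet.inter ((le_sup_left : m ≤ m ⊔ h) _ ha) ((le_sup_right : h ≤ m ⊔ h) _ hb)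

/-- If `h` is independent of `m ⊔ m₂`, then `m ⊔ h`, and hence every `m₁` inside it, is
conditionally independent of `m₂` given `m`: the part of `m₁` not already known from `m` is fresh
noise. -/
theorem condIndepGiven_of_indep_sup {Ω : Type*} {m₁ m₂ m h : MeasurableSpace Ω}
    [mΩ : MeasurableSpace Ω] [StandardBorelSpace Ω]
    {π : Measure Ω} [IsProbabilityMeasure π] (hm : m ≤ mΩ)
    (hm₂ : m₂ ≤ mΩ) (hh : h ≤ mΩ) (hind : Indep h (m ⊔ m₂) π) (hle : m₁ ≤ m ⊔ h) :
    CondIndepGiven π m₁ m₂ m := by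
  have hmm₂ : m ⊔ m₂ ≤ mΩ := sup_le hm hm₂
  have hmh : m ⊔ h ≤ mΩ := sup_le hm hh
  have int1 : ∀ s, MeasurableSet[mΩ] s → Integrable (s.indicator fun _ => (1 : ℝ)) π :=
    fun s hs => (integrable_const _).indicator hs
  have key : ∀ b c, MeasurableSet[h] b → MeasurableSet[m ⊔ m₂] c →
      π⟦b ∩ c | m⟧ =ᵐ[π] fun ω => π.real b * (π⟦c | m⟧) ω := by
    intro b c hb hc
    have e : (b ∩ c).indicator (fun _ => (1 : ℝ)) = c.indicator (b.indicator fun _ => (1 : ℝ)) := by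
      rw [Set.indicator_indicator, Set.inter_comm]
    have h1 : π⟦b | m ⊔ m₂⟧ =ᵐ[π] fun _ => π.real b := by
      refine (condExp_indep_eq hh hmm₂ (stronglyMeasurable_const.indicator hb) hind).trans ?_
      have : ∫ x, b.indicator (fun _ => (1 : ℝ)) x ∂π = π.real b :=
        integral_indicator_one (hh _ hb)
      simp [this]
    have h2 : π⟦b ∩ c | m ⊔ m₂⟧ =ᵐ[π] fun ω => π.real b * c.indicator (fun _ => (1 : ℝ)) ω := by
      rw [e]
      refine (condExp_indicator (int1 b (hh _ hb)) hc).trans ?_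
      filter_upwards [h1] with ω hω
      by_cases hωc : ω ∈ c <;> simp [hωc, hω]
    refine (condExp_condExp_of_le le_sup_left hmm₂).symm.trans ?_
    refine (condExp_congr_ae h2).trans ?_
    exact condExp_smul (π.real b) (c.indicator fun _ => (1 : ℝ)) m
  have hc : CondIndep m (m ⊔ h) m₂ hm π := by
    rw [sup_eq_generateFrom_inter m h, ← @MeasurableSpace.generateFrom_measurableSet _ m₂]
    have hgen : ∀ s ∈ {s | ∃ a b, MeasurableSet[m] a ∧ MeasurableSet[h] b ∧ s = a ∩ b},
        MeasurableSet[mΩ] s := by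
      rintro _ ⟨a, b, ha, hb, rfl⟩
      exact (hm _ ha).inter (hh _ hb)
    refine CondIndepSets.condIndep' hgen (fun s hs => hm₂ s hs)
      (isPiSystem_inter_of_measurableSpaces m h) (@MeasurableSpace.isPiSystem_measurableSet _ m₂) ?_
    refine (condIndepSets_iff m hm _ {s | MeasurableSet[m₂] s} hgen (fun s hs => hm₂ s hs) π).2 ?_
    rintro _ s ⟨a, b, ha, hb, rfl⟩ hs
    have ha' : MeasurableSet[m ⊔ m₂] a := (le_sup_left : m ≤ m ⊔ m₂) _ ha
    have hs' : MeasurableSet[m ⊔ m₂] s := (le_sup_right : m₂ ≤ m ⊔ m₂) _ hs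
    have e1 : a ∩ b ∩ s = b ∩ (a ∩ s) := by rw [Set.inter_comm a b, Set.inter_assoc]
    have e2 : a ∩ b = b ∩ a := Set.inter_comm a b
    have h1 := key b (a ∩ s) hb (ha'.inter hs')
    have h2 := key b a hb ha'
    have h3 : π⟦a | m⟧ = a.indicator fun _ => (1 : ℝ) :=
      condExp_of_stronglyMeasurable hm (stronglyMeasurable_const.indicator ha) (int1 a (hm _ ha))
    have h4 : π⟦a ∩ s | m⟧ =ᵐ[π] a.indicator (π⟦s | m⟧) := by
      rw [← Set.indicator_indicator]
      exact condExp_indicator (int1 s (hm₂ _ hs)) ha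
    rw [e1, e2]
    filter_upwards [h1, h2, h4] with ω h1 h2 h4
    rw [h1, Pi.mul_apply, h2, h4, h3]
    by_cases hωa : ω ∈ a <;> simp [hωa]
  intro s₁ s₂ hs₁ hs₂
  exact (condIndep_iff m (m ⊔ h) m₂ hm hmh hm₂ π).1 hc s₁ s₂ (hle _ hs₁) hs₂

/-- If `m₁ ⊇ m` and `m₂` are conditionally independent given `m`, an `m₁`-measurable variable
which is conditionally centred given `m` is uncorrelated with every `m₂`-measurable one. -/
theorem AdaptedGaussian.CondIndepGiven.integral_mul_eq_zero {Ω : Type*}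
    {m₁ m₂ m : MeasurableSpace Ω} [mΩ : MeasurableSpace Ω] {π : Measure Ω} [IsProbabilityMeasure π]
    (hci : CondIndepGiven π m₁ m₂ m) (hm₁ : m₁ ≤ mΩ) (hm₂ : m₂ ≤ mΩ) (hm : m ≤ m₁) {f g : Ω → ℝ}
    (hf : StronglyMeasurable[m₁] f) (hg : StronglyMeasurable[m₂] g) (hf2 : MemLp f 2 π)
    (hg2 : MemLp g 2 π) (hf0 : π[f | m] =ᵐ[π] 0) : ∫ ω, f ω * g ω ∂π = 0 := by
  have hmΩ : m ≤ mΩ := hm.trans hm₁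
  have hfi : Integrable f π := hf2.integrable (by norm_num)
  have hfg : Integrable (f * g) π := hf2.integrable_mul hg2
  have int1 : ∀ s, MeasurableSet[mΩ] s → Integrable (s.indicator fun _ => (1 : ℝ)) π :=
    fun s hs => (integrable_const _).indicator hs
  have bdd : ∀ s, MeasurableSet[mΩ] s → ∀ᵐ ω ∂π, ‖(π⟦s | m⟧) ω‖ ≤ 1 := by
    intro s hs
    exact ae_bdd_abs_condExp_of_ae_bdd_abs (m := m) (R := (1 : ℝ)) (μ := π)
      (f := s.indicator fun _ => (1 : ℝ)) (.of_forall fun ω => by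
        by_cases h : ω ∈ s <;> simp [h])
  have cond₁ : ∀ s, MeasurableSet[m₂] s → π⟦s | m₁⟧ =ᵐ[π] π⟦s | m⟧ := by
    intro s hs
    refine (ae_eq_condExp_of_forall_setIntegral_eq hm₁ (int1 s (hm₂ _ hs))
      (fun _ _ _ => integrable_condExp.integrableOn) (fun t ht _ => ?_)
      (stronglyMeasurable_condExp.mono hm).aestronglyMeasurable).symm
    have e1 : ∫ ω in t, (π⟦s | m⟧) ω ∂π = ∫ ω, (π⟦t | m⟧ * π⟦s | m⟧) ω ∂π := by
      have h1 : ∫ ω in t, (π⟦s | m⟧) ω ∂π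
          = ∫ ω, ((t.indicator fun _ => (1 : ℝ)) * π⟦s | m⟧) ω ∂π := by
        rw [← integral_indicator (hm₁ _ ht)]
        refine integral_congr_ae (.of_forall fun ω => ?_)
        by_cases h : ω ∈ t <;> simp [h]
      rw [h1, ← integral_condExp hmΩ]
      refine integral_congr_ae ?_
      refine condExp_mul_of_stronglyMeasurable_right stronglyMeasurable_condExp ?_
        (int1 t (hm₁ _ ht))
      exact (int1 t (hm₁ _ ht)).mul_bdd (c := 1)
        (stronglyMeasurable_condExp.mono hmΩ).aestronglyMeasurable (bdd s (hm₂ _ hs))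
    rw [e1, ← integral_congr_ae (hci t s ht hs), integral_condExp hmΩ]
    rw [← integral_indicator (hm₁ _ ht), Set.indicator_indicator]
  have hf₂ : π[f | m₂] =ᵐ[π] 0 := by
    refine (ae_eq_condExp_of_forall_setIntegral_eq hm₂ hfi
      (fun _ _ _ => (integrable_zero _ _ _).integrableOn) (fun s hs _ => ?_)
      stronglyMeasurable_zero.aestronglyMeasurable).symm
    have e0 : ∫ ω in s, f ω ∂π = ∫ ω, (f * s.indicator fun _ => (1 : ℝ)) ω ∂π := by
      rw [← integral_indicator (hm₂ _ hs)]
      refine integral_congr_ae (.of_forall fun ω => ?_)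
      by_cases h : ω ∈ s <;> simp [h]
    have i1 : Integrable (f * s.indicator fun _ => (1 : ℝ)) π :=
      hfi.mul_bdd (c := 1) (int1 s (hm₂ _ hs)).aestronglyMeasurable (.of_forall fun ω => by
        by_cases h : ω ∈ s <;> simp [h])
    have i2 : Integrable (f * π⟦s | m⟧) π :=
      hfi.mul_bdd (c := 1) (stronglyMeasurable_condExp.mono hmΩ).aestronglyMeasurable
        (bdd s (hm₂ _ hs))
    have e1 : ∫ ω, (f * s.indicator fun _ => (1 : ℝ)) ω ∂π = ∫ ω, (f * π⟦s | m⟧) ω ∂π := by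
      rw [← integral_condExp hm₁]
      refine integral_congr_ae ((condExp_mul_of_stronglyMeasurable_left hf i1
        (int1 s (hm₂ _ hs))).trans ?_)
      filter_upwards [cond₁ s hs] with ω hω
      simp [hω]
    have e2 : ∫ ω, (f * π⟦s | m⟧) ω ∂π = 0 := by
      rw [← integral_condExp hmΩ]
      refine integral_eq_zero_of_ae ((condExp_mul_of_stronglyMeasurable_right
        stronglyMeasurable_condExp i2 hfi).trans ?_)
      filter_upwards [hf0] with ω hω
      simp [hω]
    rw [e0, e1, e2]
    simp
  change ∫ ω, (f * g) ω ∂π = 0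
  rw [← integral_condExp hm₂]
  refine integral_eq_zero_of_ae ((condExp_mul_of_stronglyMeasurable_right hg hfg hfi).trans ?_)
  filter_upwards [hf₂] with ω hω
  simp [hω]

/-! ### The filtration of the coordinate process -/

theorem measurable_coord_pathFiltration {N d : ℕ} {t : Fin N} {k : Idx N d}
    (hk : (ofLex k).1 ≤ t) : Measurable[pathFiltration N d t] fun x : PathSpace N d => x k :=
  (PiLp.continuous_apply 2 _ (ofLex k).2).measurable.comp (measurable_block_pathFiltration hk)

theorem comap_pathFiltration_le {Ω : Type*} {N d : ℕ} {m : MeasurableSpace Ω}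
    {f : Ω → PathSpace N d} {t : Fin N}
    (hf : ∀ k : Idx N d, (ofLex k).1 ≤ t → Measurable[m] fun ω => f ω k) :
    (pathFiltration N d t).comap f ≤ m := by
  have hF : pathFiltration N d t
      = ⨆ j ≤ t, MeasurableSpace.comap (block (d := d) j) inferInstance := by
    simp only [pathFiltration, Filtration.natural, BorelSpace.measurable_eq]
  rw [hF]
  simp only [MeasurableSpace.comap_iSup, MeasurableSpace.comap_comp]
  refine iSup₂_le fun j hj => ?_
  rw [← measurable_iff_comap_le]
  have h : Measurable[m] fun ω => ((block j ∘ f) ω).ofLp :=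
    (@measurable_pi_iff _ _ _ m _ _).2 fun i => hf (toLex (j, i)) hj
  exact (WithLp.measurable_toLp 2 (Fin d → ℝ)).comp h

theorem comap_pathSpace_le {Ω : Type*} {N d : ℕ} {m : MeasurableSpace Ω}
    {f : Ω → PathSpace N d} (hf : ∀ k : Idx N d, Measurable[m] fun ω => f ω k) :
    MeasurableSpace.comap f inferInstance ≤ m := by
  rw [← measurable_iff_comap_le]
  exact (WithLp.measurable_toLp 2 (Idx N d → ℝ)).comp
    ((@measurable_pi_iff _ _ _ m _ fun ω => (f ω).ofLp).2 hf)

/-! ### Inverting a minimal Cholesky factor -/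

/-- A minimal Cholesky factor `L` has a lower triangular left inverse `R` on the coordinates with
nonzero diagonal entry: `R * L` is the projection onto these coordinates, which `L` absorbs. The
matrix `R` is itself invertible. -/
theorem AdaptedGaussian.IsMinCholesky.exists_lower_inverse {n : Type*} [Fintype n] [LinearOrder n]
    {A L : Matrix n n ℝ} (hL : IsMinCholesky A L) :
    ∃ (R K : Matrix n n ℝ) (δ : n → ℝ), (∀ i, δ i = 0 ∨ δ i = 1) ∧ K * R = 1 ∧
      (∀ i j, i < j → R i j = 0) ∧ R * L = diagonal δ ∧ L * diagonal δ = L := by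
  let δ : n → ℝ := fun i => if L i i = 0 then 0 else 1
  have hLδ : L * diagonal δ = L := by
    ext i j
    rw [mul_diagonal]
    by_cases hj : L j j = 0
    · rcases lt_or_ge i j with h | h
      · simp [hL.lower i j h]
      · simp [hL.column_zero j hj i h]
    · simp [δ, hj]
  -- the vanishing columns of `L` are completed by unit vectors
  let K : Matrix n n ℝ := L + diagonal fun i => 1 - δ i
  have hK : K.BlockTriangular OrderDual.toDual := by
    intro i j hij
    have hij' : i < j := hij
    simp [K, hL.lower i j hij', hij'.ne]
  have hdet : K.det ≠ 0 := by
    rw [det_of_isLowerTriangular K hK, Finset.prod_ne_zero_iff]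
    intro i _
    by_cases hi : L i i = 0 <;> simp [K, δ, hi]
  have hu : IsUnit K.det := isUnit_iff_ne_zero.2 hdet
  let _ := K.invertibleOfIsUnitDet hu
  have hKδ : K * diagonal δ = L := by
    rw [add_mul, hLδ, diagonal_mul_diagonal]
    have : (fun i => (1 - δ i) * δ i) = 0 := by
      ext i
      by_cases hi : L i i = 0 <;> simp [δ, hi]
    rw [this]
    simp
  refine ⟨K⁻¹, K, δ, fun i => ?_, mul_nonsing_inv K hu, fun i j hij => ?_, ?_, hLδ⟩
  · by_cases hi : L i i = 0 <;> simp [δ, hi]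
  · exact blockTriangular_inv_of_blockTriangular hK hij
  · conv_lhs => rw [← hKδ]
    rw [← mul_assoc, nonsing_inv_mul K hu, one_mul]

/-! ### Affine images of the standard Gaussian measure -/

theorem measurable_affine {n : Type*} [Fintype n] (a : EuclideanSpace ℝ n) (L : Matrix n n ℝ) :
    Measurable fun x : EuclideanSpace ℝ n => a + WithLp.toLp 2 (L *ᵥ x.ofLp) := by
  have : Measurable fun x : EuclideanSpace ℝ n => L *ᵥ x.ofLp := by
    refine measurable_pi_iff.2 fun i => ?_
    simp only [mulVec, dotProduct]
    fun_prop
  exact ((WithLp.measurable_toLp 2 _).comp this).const_add a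

theorem map_stdGaussian_eq_multivariateGaussian {n : Type*} [Fintype n] [DecidableEq n]
    (a : EuclideanSpace ℝ n) {A L : Matrix n n ℝ} (hA : A.PosSemidef) (hL : L * Lᵀ = A) :
    (stdGaussian (EuclideanSpace ℝ n)).map (fun x => a + WithLp.toLp 2 (L *ᵥ x.ofLp))
      = multivariateGaussian a A := by
  let T := toEuclideanCLM (𝕜 := ℝ) (n := n) L
  have hT : (fun x : EuclideanSpace ℝ n => a + WithLp.toLp 2 (L *ᵥ x.ofLp))
      = (fun x => a + x) ∘ T := by
    ext x; simp [T]
  have hmap : (stdGaussian (EuclideanSpace ℝ n)).map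
      (fun x => a + WithLp.toLp 2 (L *ᵥ x.ofLp)) = ((stdGaussian _).map T).map (fun x => a + x) := by
    rw [hT, Measure.map_map (measurable_const_add a) (by fun_prop)]
  rw [hmap]
  apply IsGaussian.ext
  · simp only [id_eq, integral_id_multivariateGaussian]
    rw [integral_map (by fun_prop) (by fun_prop), integral_add (integrable_const _)]
    · rw [ContinuousLinearMap.integral_id_map]
      · simp
      · exact IsGaussian.integrable_id
    · exact IsGaussian.integrable_id
  · ext x y
    rw [covarianceBilin_map_const_add, covarianceBilin_map IsGaussian.memLp_two_id,
      covarianceBilin_stdGaussian, innerSL_apply_apply, covarianceBilin_multivariateGaussian hA,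
      ContinuousLinearMap.adjoint_inner_left, ← ContinuousLinearMap.star_eq_adjoint, ← map_star,
      ← ContinuousLinearMap.comp_apply, ← ContinuousLinearMap.mul_def, ← map_mul,
      inner_toEuclideanCLM, ← hL, star_eq_conjTranspose, conjTranspose_eq_transpose_of_trivial]

theorem iIndepFun_coord_stdGaussian (n : Type*) [Fintype n] :
    iIndepFun (fun (k : n) (x : EuclideanSpace ℝ n) => x k)
      (stdGaussian (EuclideanSpace ℝ n)) := by
  have hpi : (stdGaussian (EuclideanSpace ℝ n)).map (fun x k => x k)
      = Measure.pi fun _ : n => gaussianReal 0 1 := by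
    rw [← map_pi_eq_stdGaussian, Measure.map_map (by fun_prop) (by fun_prop)]
    exact Measure.map_id
  rw [iIndepFun_iff_map_fun_eq_pi_map fun k => by fun_prop, hpi]
  congr 1 with k : 1
  rw [← (measurePreserving_eval (fun _ : n => gaussianReal 0 1) k).map_eq, ← hpi,
    Measure.map_map (by fun_prop) (by fun_prop)]
  rfl

theorem memLp_coord_stdGaussian {n : Type*} [Fintype n] (k : n) :
    MemLp (fun x : EuclideanSpace ℝ n => x k) 2 (stdGaussian (EuclideanSpace ℝ n)) :=
  IsGaussian.memLp_dual _ (EuclideanSpace.proj k : StrongDual ℝ (EuclideanSpace ℝ n)) 2 (by simp)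

theorem integral_coord_stdGaussian {n : Type*} [Fintype n] (k : n) :
    ∫ x : EuclideanSpace ℝ n, x k ∂stdGaussian (EuclideanSpace ℝ n) = 0 :=
  integral_strongDual_stdGaussian (EuclideanSpace.proj k : StrongDual ℝ (EuclideanSpace ℝ n))

theorem integral_coord_mul_stdGaussian {n : Type*} [Fintype n] [DecidableEq n] (k l : n) :
    ∫ x : EuclideanSpace ℝ n, x k * x l ∂stdGaussian (EuclideanSpace ℝ n)
      = (1 : Matrix n n ℝ) k l := by
  have h := covariance_eval_multivariateGaussian (μ := 0) (PosSemidef.one (n := n) (R := ℝ)) k l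
  rw [multivariateGaussian_zero_one, covariance_eq_sub (memLp_coord_stdGaussian k)
    (memLp_coord_stdGaussian l), integral_coord_stdGaussian] at h
  simpa using h

/-! ### Conditional independence for linear images of Gaussian noise -/

theorem indep_map_of_indep_comap {Ω Ω' : Type*} {m₁ m₂ : MeasurableSpace Ω'}
    [mΩ : MeasurableSpace Ω] [mΩ' : MeasurableSpace Ω'] {ν : Measure Ω} {φ : Ω → Ω'}
    (hφ : Measurable φ) (h₁ : m₁ ≤ mΩ') (h₂ : m₂ ≤ mΩ')
    (h : Indep (m₁.comap φ) (m₂.comap φ) ν) : Indep m₁ m₂ (ν.map φ) := by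
  rw [Indep_iff] at h ⊢
  intro s t hs ht
  rw [Measure.map_apply hφ ((h₁ _ hs).inter (h₂ _ ht)), Measure.map_apply hφ (h₁ _ hs),
    Measure.map_apply hφ (h₂ _ ht), Set.preimage_inter]
  exact h _ _ ⟨s, hs, rfl⟩ ⟨t, ht, rfl⟩

theorem measurable_mulVec_apply {Ω n l : Type*} [Fintype n] {m : MeasurableSpace Ω}
    (L : Matrix l n ℝ) (v : Ω → n → ℝ) (k : l)
    (hv : ∀ j, L k j ≠ 0 → Measurable[m] fun ω => v ω j) :
    Measurable[m] fun ω => (L *ᵥ v ω) k := by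
  simp only [mulVec, dotProduct]
  refine Finset.measurable_fun_sum _ fun j _ => ?_
  by_cases hj : L k j = 0
  · simp [hj]
  · exact (hv j hj).const_mul _

theorem measurable_coord_comap {n : Type*} [Fintype n] (S : Finset n) {k : n} (hk : k ∈ S) :
    Measurable[MeasurableSpace.comap (fun (x : EuclideanSpace ℝ n) (k : S) => x k) inferInstance]
      fun x : EuclideanSpace ℝ n => x k :=
  (measurable_pi_apply (⟨k, hk⟩ : S)).comp
    (comap_measurable fun (x : EuclideanSpace ℝ n) (k : S) => x k)

theorem indep_coord_stdGaussian {n : Type*} [Fintype n] (S T : Finset n)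
    (hST : Disjoint S T) : Indep
      (MeasurableSpace.comap (fun (x : EuclideanSpace ℝ n) (k : S) => x k) inferInstance)
      (MeasurableSpace.comap (fun (x : EuclideanSpace ℝ n) (k : T) => x k) inferInstance)
      (stdGaussian (EuclideanSpace ℝ n)) :=
  (iIndepFun_coord_stdGaussian n).indepFun_finset S T hST fun k => by fun_prop

theorem comap_pathFiltration_linear_le {N d : ℕ} (c : PathSpace N d)
    {L : Matrix (Idx N d) (Idx N d) ℝ} (hL : ∀ i j, (ofLex i).1 < (ofLex j).1 → L i j = 0)
    (t : Fin N) :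
    (pathFiltration N d t).comap (fun ε => c + WithLp.toLp 2 (L *ᵥ ε.ofLp)) ≤
      MeasurableSpace.comap (fun (x : PathSpace N d)
        (k : ({k : Idx N d | (ofLex k).1 ≤ t} : Finset (Idx N d))) => x k) inferInstance := by
  refine comap_pathFiltration_le fun k hk => ?_
  refine Measurable.const_add (measurable_mulVec_apply L
    (fun ε : PathSpace N d => ε.ofLp) k fun j hj => ?_) (c k)
  have hjk : (ofLex j).1 ≤ (ofLex k).1 := not_lt.1 fun h => hj (hL k j h)
  exact measurable_coord_comap _ (by simpa using hjk.trans hk)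

/-- Let `f = a + L ε` and `g = b + M ε` with `L`, `M` block lower triangular and `ε` standard
Gaussian. If some invertible block lower triangular `R` makes `R L` block upper triangular, then
the path of `f` is conditionally independent of `g` up to time `t`, given `f` up to time `t`: the
later blocks of `R (f - a)`, which complete the information about `f`, only depend on later
noise. -/
theorem condIndepGiven_linear_stdGaussian {Ω : Type*} [mΩ : MeasurableSpace Ω]
    [StandardBorelSpace Ω] {N d : ℕ} {φ : PathSpace N d → Ω} (hφ : Measurable φ)
    {f g : Ω → PathSpace N d} (hf : Measurable f) (hg : Measurable g) {a b : PathSpace N d}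
    {L M R K : Matrix (Idx N d) (Idx N d) ℝ}
    (hL : ∀ i j, (ofLex i).1 < (ofLex j).1 → L i j = 0)
    (hM : ∀ i j, (ofLex i).1 < (ofLex j).1 → M i j = 0)
    (hR : ∀ i j, (ofLex i).1 < (ofLex j).1 → R i j = 0) (hKR : K * R = 1)
    (hRL : ∀ i j, (ofLex j).1 < (ofLex i).1 → (R * L) i j = 0)
    (hfφ : ∀ ε, f (φ ε) = a + WithLp.toLp 2 (L *ᵥ ε.ofLp))
    (hgφ : ∀ ε, g (φ ε) = b + WithLp.toLp 2 (M *ᵥ ε.ofLp)) (t : Fin N) :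
    CondIndepGiven ((stdGaussian (PathSpace N d)).map φ)
      (MeasurableSpace.comap f inferInstance) ((pathFiltration N d t).comap g)
      ((pathFiltration N d t).comap f) := by
  have : IsProbabilityMeasure ((stdGaussian (PathSpace N d)).map φ) :=
    Measure.isProbabilityMeasure_map hφ.aemeasurable
  let S : Finset (Idx N d) := {k | t < (ofLex k).1}
  let T : Finset (Idx N d) := {k | (ofLex k).1 ≤ t}
  have hST : Disjoint S T := by
    rw [Finset.disjoint_filter]
    exact fun k _ => not_le.2
  let r : Ω → Idx N d → ℝ := fun ω => R *ᵥ (f ω - a).ofLp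
  let H : Ω → S → ℝ := fun ω k => r ω k
  have hcoord : ∀ k, Measurable fun ω => (f ω - a).ofLp k := fun k =>
    (((measurable_pi_apply k).comp ((WithLp.measurable_ofLp 2 _).comp hf)).sub_const (a k))
  have hH : Measurable H := measurable_pi_iff.2 fun k =>
    measurable_mulVec_apply R (fun ω => (f ω - a).ofLp) k fun j _ => hcoord j
  have hf' : (pathFiltration N d t).comap f ≤ mΩ :=
    (MeasurableSpace.comap_mono ((pathFiltration N d).le t)).trans hf.comap_le
  have hg' : (pathFiltration N d t).comap g ≤ mΩ :=
    (MeasurableSpace.comap_mono ((pathFiltration N d).le t)).trans hg.comap_le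
  refine condIndepGiven_of_indep_sup (h := MeasurableSpace.comap H inferInstance) hf' hg'
    hH.comap_le ?_ ?_
  · refine indep_map_of_indep_comap hφ hH.comap_le (sup_le hf' hg') ?_
    refine indep_of_indep_of_le_left (indep_of_indep_of_le_right
      (indep_coord_stdGaussian S T hST) ?_) ?_
    · rw [MeasurableSpace.comap_sup, MeasurableSpace.comap_comp, MeasurableSpace.comap_comp]
      refine sup_le ?_ ?_
      · rw [show f ∘ φ = _ from funext hfφ]
        exact comap_pathFiltration_linear_le a hL t
      · rw [show g ∘ φ = _ from funext hgφ]
        exact comap_pathFiltration_linear_le b hM t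
    · rw [MeasurableSpace.comap_comp, ← measurable_iff_comap_le]
      have hHφ : H ∘ φ = fun (ε : PathSpace N d) (k : S) => ((R * L) *ᵥ ε.ofLp) k := by
        funext ε k
        simp [H, r, hfφ, mulVec_mulVec]
      rw [hHφ]
      refine @measurable_pi_iff _ _ _ (MeasurableSpace.comap _ _) _ _ |>.2 fun k => ?_
      refine measurable_mulVec_apply (R * L) (fun ε : PathSpace N d => ε.ofLp) k fun j hj => ?_
      have hjS : j ∈ S := by
        have h1 : (ofLex (k : Idx N d)).1 ≤ (ofLex j).1 := not_lt.1 fun h => hj (hRL k j h)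
        have h2 : t < (ofLex (k : Idx N d)).1 := (Finset.mem_filter.1 k.2).2
        simpa [S] using h2.trans_le h1
      exact measurable_coord_comap S hjS
  · set m := (pathFiltration N d t).comap f
    set h := MeasurableSpace.comap H inferInstance
    have hr : ∀ k, Measurable[m ⊔ h] fun ω => r ω k := by
      intro k
      rcases le_or_gt (ofLex k).1 t with hk | hk
      · refine measurable_mulVec_apply R (fun ω => (f ω - a).ofLp) k fun j hj => ?_
        have hjk : (ofLex j).1 ≤ (ofLex k).1 := not_lt.1 fun h => hj (hR k j h)
        have h1 : Measurable[m] fun ω => f ω j :=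
          (measurable_coord_pathFiltration (hjk.trans hk)).comp (comap_measurable f)
        exact (h1.mono le_sup_left le_rfl).sub_const (a j)
      · have hkS : k ∈ S := by simpa [S] using hk
        have h1 : Measurable[h] fun ω => r ω k :=
          (measurable_pi_apply (⟨k, hkS⟩ : S)).comp (comap_measurable H)
        exact h1.mono le_sup_right le_rfl
    refine comap_pathSpace_le fun k => ?_
    have hfr : (fun ω => f ω k) = fun ω => a k + (K *ᵥ r ω) k := by
      funext ω
      simp [r, mulVec_mulVec, hKR]
    rw [hfr]
    exact (measurable_mulVec_apply K r k fun j _ => hr j).const_add (a k)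

/-- Driving `a + L ε` and `b + M ε` by the same Gaussian noise is bicausal as soon as both factors
are block lower triangular, and block diagonal up to an invertible block lower triangular factor. -/
theorem isBicausal_canonical_of_linear {N d : ℕ} {μ ν : Measure (PathSpace N d)}
    [IsProbabilityMeasure μ] [IsProbabilityMeasure ν] {a b : PathSpace N d}
    {L M R K R' K' : Matrix (Idx N d) (Idx N d) ℝ}
    (hμ : (stdGaussian (PathSpace N d)).map (fun ε => a + WithLp.toLp 2 (L *ᵥ ε.ofLp)) = μ)
    (hν : (stdGaussian (PathSpace N d)).map (fun ε => b + WithLp.toLp 2 (M *ᵥ ε.ofLp)) = ν)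
    (hL : ∀ i j, (ofLex i).1 < (ofLex j).1 → L i j = 0)
    (hM : ∀ i j, (ofLex i).1 < (ofLex j).1 → M i j = 0)
    (hR : ∀ i j, (ofLex i).1 < (ofLex j).1 → R i j = 0) (hKR : K * R = 1)
    (hRL : ∀ i j, (ofLex j).1 < (ofLex i).1 → (R * L) i j = 0)
    (hR' : ∀ i j, (ofLex i).1 < (ofLex j).1 → R' i j = 0) (hKR' : K' * R' = 1)
    (hRM' : ∀ i j, (ofLex j).1 < (ofLex i).1 → (R' * M) i j = 0) :
    IsBicausal (canonical μ) (canonical ν)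
      ((stdGaussian (PathSpace N d)).map fun ε =>
        (a + WithLp.toLp 2 (L *ᵥ ε.ofLp), b + WithLp.toLp 2 (M *ᵥ ε.ofLp))) := by
  have hφ : Measurable fun ε : PathSpace N d =>
      (a + WithLp.toLp 2 (L *ᵥ ε.ofLp), b + WithLp.toLp 2 (M *ᵥ ε.ofLp)) :=
    (measurable_affine a L).prodMk (measurable_affine b M)
  have hsup : (⨆ s, pathFiltration N d s) ≤ (inferInstance : MeasurableSpace (PathSpace N d)) :=
    iSup_le fun s => (pathFiltration N d).le s
  refine ⟨?_, ?_, fun t => ?_, fun t => ?_⟩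
  · exact (Measure.map_map measurable_fst hφ).trans hμ
  · exact (Measure.map_map measurable_snd hφ).trans hν
  · have h := condIndepGiven_linear_stdGaussian hφ measurable_fst measurable_snd hL hM hR hKR hRL
      (fun _ => rfl) (fun _ => rfl) t
    simp only [MeasurableSpace.prod, MeasurableSpace.comap_bot, bot_sup_eq, sup_bot_eq]
    intro s₁ s₂ h₁ h₂
    exact h s₁ s₂ (MeasurableSpace.comap_mono hsup _ h₁) h₂
  · have h := condIndepGiven_linear_stdGaussian hφ measurable_snd measurable_fst hM hL hR' hKR'
      hRM' (fun _ => rfl) (fun _ => rfl) t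
    simp only [MeasurableSpace.prod, MeasurableSpace.comap_bot, bot_sup_eq, sup_bot_eq]
    intro s₁ s₂ h₁ h₂
    exact h s₁ s₂ (MeasurableSpace.comap_mono hsup _ h₁) h₂

/-! ### The nuclear norm -/

/-- A singular value decomposition `C = W Σ Vᵀ`; the nuclear norm is the sum of the singular
values. -/
theorem exists_singularValueDecomposition {n : Type*} [Fintype n] [DecidableEq n]
    (C : Matrix n n ℝ) : ∃ (W V : Matrix n n ℝ) (σ : n → ℝ), Wᵀ * W = 1 ∧ Vᵀ * V = 1 ∧
      (∀ i, 0 ≤ σ i) ∧ C = W * diagonal σ * Vᵀ ∧ ∑ i, σ i = nuclearNorm C := by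
  have hCC : (Cᵀ * C).PosSemidef := by
    simpa [conjTranspose_eq_transpose_of_trivial] using posSemidef_conjTranspose_mul_self C
  set S := CFC.sqrt (Cᵀ * C) with hS
  have hSS : S * S = Cᵀ * C := CFC.sqrt_mul_sqrt_self _ hCC.nonneg
  have hSpos : S.PosSemidef := nonneg_iff_posSemidef.1 (CFC.sqrt_nonneg _)
  have hSh := hSpos.isHermitian
  let V : Matrix n n ℝ := hSh.eigenvectorUnitary
  let σ := hSh.eigenvalues
  have hV : Vᵀ * V = 1 := by
    have := Unitary.coe_star_mul_self hSh.eigenvectorUnitary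
    simpa [V, star_eq_conjTranspose, conjTranspose_eq_transpose_of_trivial] using this
  have hV' : V * Vᵀ = 1 := mul_eq_one_comm.1 hV
  have hspec : S = V * diagonal σ * Vᵀ := by
    have := hSh.spectral_theorem
    simpa [Unitary.conjStarAlgAut_apply, V, σ, star_eq_conjTranspose,
      conjTranspose_eq_transpose_of_trivial, Function.comp_def] using this
  have hB : (C * V)ᵀ * (C * V) = diagonal fun i => σ i * σ i := by
    calc (C * V)ᵀ * (C * V) = Vᵀ * (Cᵀ * C) * V := by simp only [transpose_mul, mul_assoc]
      _ = (Vᵀ * V) * diagonal σ * (Vᵀ * V) * diagonal σ * (Vᵀ * V) := by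
        rw [← hSS, hspec]; simp only [mul_assoc]
      _ = _ := by simp [hV]
  -- the columns of `C V` are orthogonal; the normalized nonzero ones extend to a basis
  have hdot : ∀ i j, ∑ k, (C * V) k i * (C * V) k j = if i = j then σ i * σ i else 0 := by
    intro i j
    have := congrFun (congrFun hB i) j
    rwa [mul_apply, diagonal_apply] at this
  let v : n → EuclideanSpace ℝ n := fun i => WithLp.toLp 2 fun k => (σ i)⁻¹ * (C * V) k i
  have hv : Orthonormal ℝ (({i | σ i ≠ 0} : Set n).domRestrict v) := by
    rw [orthonormal_iff_ite]
    rintro ⟨i, hi⟩ ⟨j, hj⟩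
    have h1 : inner ℝ (v i) (v j)
        = (σ i)⁻¹ * (σ j)⁻¹ * ∑ k, (C * V) k i * (C * V) k j := by
      simp only [v, PiLp.inner_apply, RCLike.inner_apply, conj_trivial, Finset.mul_sum]
      exact Finset.sum_congr rfl fun k _ => by ring
    change inner ℝ (v i) (v j) = _
    rw [h1, hdot]
    have hi' : σ i ≠ 0 := hi
    by_cases hij : i = j
    · subst hij
      simp
      field_simp
    · simp [hij]
  obtain ⟨w, hw⟩ := hv.exists_orthonormalBasis_extension_of_card_eq (by simp)
  let W : Matrix n n ℝ := Matrix.of fun k i => w i k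
  have hW : Wᵀ * W = 1 := by
    ext i j
    have := orthonormal_iff_ite.1 w.orthonormal i j
    rw [mul_apply, one_apply, ← this]
    simp [W, PiLp.inner_apply, mul_comm]
  have hCV : C * V = W * diagonal σ := by
    ext k i
    rw [mul_diagonal]
    by_cases hi : σ i = 0
    · have h0 := hdot i i
      simp only [hi, if_true, mul_zero] at h0
      rw [Finset.sum_eq_zero_iff_of_nonneg fun k _ => mul_self_nonneg _] at h0
      simpa [hi] using h0 k (Finset.mem_univ k)
    · simp only [W, Matrix.of_apply, hw i hi, v]
      field_simp
  refine ⟨W, V, σ, hW, hV, hSpos.eigenvalues_nonneg, ?_, ?_⟩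
  · rw [← hCV, mul_assoc, hV', mul_one]
  · have := hSh.trace_eq_sum_eigenvalues
    simpa [nuclearNorm] using this.symm

/-- The nuclear norm is attained in its duality with the contractions, at an orthogonal matrix. -/
theorem exists_orthogonal_trace_eq_nuclearNorm {n : Type*} [Fintype n] [DecidableEq n]
    (C : Matrix n n ℝ) : ∃ Q : Matrix n n ℝ, Qᵀ * Q = 1 ∧ (Cᵀ * Q).trace = nuclearNorm C := by
  obtain ⟨W, V, σ, hW, hV, -, hC, hσ⟩ := exists_singularValueDecomposition C
  refine ⟨W * Vᵀ, ?_, ?_⟩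
  · calc (W * Vᵀ)ᵀ * (W * Vᵀ) = V * (Wᵀ * W) * Vᵀ := by
          simp only [transpose_mul, transpose_transpose, mul_assoc]
      _ = 1 := by rw [hW, mul_one, mul_eq_one_comm.1 hV]
  · have : Cᵀ * (W * Vᵀ) = V * (diagonal σ * Vᵀ) := by
      calc Cᵀ * (W * Vᵀ) = V * (diagonal σ * (Wᵀ * W) * Vᵀ) := by
            rw [hC]; simp only [transpose_mul, transpose_transpose, diagonal_transpose, mul_assoc]
        _ = _ := by rw [hW, mul_one]
    rw [this, trace_mul_comm, mul_assoc, hV, mul_one, trace_diagonal, hσ]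

/-- Duality between the nuclear norm and the operator norm. -/
theorem trace_transpose_mul_le_nuclearNorm {n : Type*} [Fintype n] [DecidableEq n]
    (C K : Matrix n n ℝ)
    (hK : ∀ u v : n → ℝ, u ⬝ᵥ u = 1 → v ⬝ᵥ v = 1 → u ⬝ᵥ K *ᵥ v ≤ 1) :
    (Cᵀ * K).trace ≤ nuclearNorm C := by
  obtain ⟨W, V, σ, hW, hV, hσ0, hC, hσ⟩ := exists_singularValueDecomposition C
  have h1 : (Cᵀ * K).trace = ∑ i, σ i * (Wᵀ i ⬝ᵥ K *ᵥ Vᵀ i) := by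
    have : (Cᵀ * K).trace = (diagonal σ * (Wᵀ * (K * V))).trace := by
      rw [hC]
      simp only [transpose_mul, transpose_transpose, diagonal_transpose, mul_assoc]
      rw [trace_mul_comm]
      simp only [mul_assoc]
    rw [this, trace]
    refine Finset.sum_congr rfl fun i _ => ?_
    rw [diag_apply, diagonal_mul]
    rfl
  rw [h1, ← hσ]
  refine Finset.sum_le_sum fun i _ => mul_le_of_le_one_right (hσ0 i) (hK _ _ ?_ ?_)
  · exact (congrFun (congrFun hW i) i).trans (one_apply_eq i)
  · exact (congrFun (congrFun hV i) i).trans (one_apply_eq i)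

theorem trace_transpose_mul_eq_sum_matBlock {N d : ℕ} (C K : Matrix (Idx N d) (Idx N d) ℝ)
    (hK : ∀ k l, (ofLex k).1 ≠ (ofLex l).1 → K k l = 0) :
    (Cᵀ * K).trace = ∑ t, ((matBlock C t t)ᵀ * matBlock K t t).trace := by
  have h : ∀ f : Idx N d → ℝ, ∑ k, f k = ∑ t, ∑ i, f (toLex (t, i)) := fun f => by
    rw [← Fintype.sum_prod_type', ← toLex.sum_comp]
  simp only [trace, diag_apply, mul_apply, transpose_apply]
  rw [h]
  refine Finset.sum_congr rfl fun t _ => Finset.sum_congr rfl fun i _ => ?_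
  rw [h, Finset.sum_eq_single t]
  · rfl
  · intro s _ hs
    exact Finset.sum_eq_zero fun j _ => by rw [hK _ _ (by simpa using hs), mul_zero]
  · simp

section

open scoped Matrix.Norms.Frobenius

theorem frobenius_norm_sq_eq_trace {n : Type*} [Fintype n] (L : Matrix n n ℝ) :
    ‖L‖ ^ 2 = (L * Lᵀ).trace := by
  have h0 : 0 ≤ ∑ i, ∑ j, ‖L i j‖ ^ (2 : ℝ) := by positivity
  rw [frobenius_norm_def, ← Real.sqrt_eq_rpow, Real.sq_sqrt h0]
  simp [trace, mul_apply, sq]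

/-- The hypothesis excludes the junk value of the square root in `distAW`. -/
theorem distAW_sq {N d : ℕ} (L M : Matrix (Idx N d) (Idx N d) ℝ)
    (h : 0 ≤ (L * Lᵀ).trace + (M * Mᵀ).trace
      - 2 * ∑ t : Fin N, nuclearNorm (matBlock (Lᵀ * M) t t)) :
    distAW L M ^ 2 = (L * Lᵀ).trace + (M * Mᵀ).trace
      - 2 * ∑ t : Fin N, nuclearNorm (matBlock (Lᵀ * M) t t) := by
  rw [distAW, frobenius_norm_sq_eq_trace, frobenius_norm_sq_eq_trace, Real.sq_sqrt h]

end

/-! ### Transport costs -/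

theorem sum_enorm_block_sub_sq {N d : ℕ} (x y : PathSpace N d) :
    ∑ t, ‖block t x - block t y‖ₑ ^ 2 = ENNReal.ofReal (∑ k, (x k - y k) ^ 2) := by
  have h : ∀ t, ‖block t x - block t y‖ₑ ^ 2
      = ENNReal.ofReal (∑ i, (x (toLex (t, i)) - y (toLex (t, i))) ^ 2) := by
    intro t
    rw [← ofReal_norm, ← ENNReal.ofReal_pow (norm_nonneg _),
      EuclideanSpace.real_norm_sq_eq]
    rfl
  simp only [h]
  rw [← ENNReal.ofReal_sum_of_nonneg fun t _ => by positivity, ← toLex.sum_comp,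
    Fintype.sum_prod_type]

/-- The second moment of `c + W ζ` for a centred vector `ζ` with covariance matrix `Γ`. -/
theorem lintegral_sum_sq_const_add_mulVec {Ω n l : Type*} [Fintype n] [Fintype l]
    [MeasurableSpace Ω] {P : Measure Ω} [IsProbabilityMeasure P] (c : n → ℝ) (W : Matrix n l ℝ)
    (ζ : Ω → l → ℝ) (Γ : Matrix l l ℝ) (h2 : ∀ j, MemLp (fun ω => ζ ω j) 2 P)
    (h0 : ∀ j, ∫ ω, ζ ω j ∂P = 0) (hΓ : ∀ i j, ∫ ω, ζ ω i * ζ ω j ∂P = Γ i j) :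
    ∫⁻ ω, ENNReal.ofReal (∑ k, (c k + (W *ᵥ ζ ω) k) ^ 2) ∂P
      = ENNReal.ofReal (∑ k, c k ^ 2 + (W * Γ * Wᵀ).trace) := by
  have i1 : ∀ j, Integrable (fun ω => ζ ω j) P := fun j => (h2 j).integrable (by norm_num)
  have i2 : ∀ i j, Integrable (fun ω => ζ ω i * ζ ω j) P := fun i j => (h2 i).integrable_mul (h2 j)
  have e : ∀ ω k, (c k + (W *ᵥ ζ ω) k) ^ 2 = c k ^ 2 + ∑ j, 2 * c k * W k j * ζ ω j
      + ∑ i, ∑ j, W k i * W k j * (ζ ω i * ζ ω j) := by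
    intro ω k
    have h1 : (∑ j, W k j * ζ ω j) * (∑ j, W k j * ζ ω j)
        = ∑ i, ∑ j, W k i * W k j * (ζ ω i * ζ ω j) := by
      rw [Finset.sum_mul_sum]
      exact Finset.sum_congr rfl fun i _ => Finset.sum_congr rfl fun j _ => by ring
    have h3 : ∑ j, 2 * c k * W k j * ζ ω j = 2 * c k * ∑ j, W k j * ζ ω j := by
      rw [Finset.mul_sum]
      exact Finset.sum_congr rfl fun j _ => by ring
    rw [← h1, h3]
    simp only [mulVec, dotProduct]
    ring
  have j1 : ∀ k, Integrable (fun ω => ∑ j, 2 * c k * W k j * ζ ω j) P := fun k =>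
    integrable_finsetSum _ fun j _ => (i1 j).const_mul _
  have j2 : ∀ k, Integrable (fun ω => ∑ i, ∑ j, W k i * W k j * (ζ ω i * ζ ω j)) P := fun k =>
    integrable_finsetSum _ fun i _ => integrable_finsetSum _ fun j _ => (i2 i j).const_mul _
  have j3 : ∀ k, Integrable (fun ω => (c k + (W *ᵥ ζ ω) k) ^ 2) P := by
    intro k
    simp only [e]
    exact ((integrable_const _).add (j1 k)).add (j2 k)
  rw [← ofReal_integral_eq_lintegral_ofReal (integrable_finsetSum _ fun k _ => j3 k)
    (.of_forall fun ω => by positivity), integral_finsetSum _ fun k _ => j3 k]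
  congr 1
  rw [trace, ← Finset.sum_add_distrib]
  refine Finset.sum_congr rfl fun k _ => ?_
  simp only [e]
  have j0 : Integrable (fun ω => c k ^ 2 + ∑ j, 2 * c k * W k j * ζ ω j) P :=
    (integrable_const _).add (j1 k)
  rw [integral_add j0 (j2 k), integral_add (integrable_const _) (j1 k),
    integral_finsetSum _ fun j _ => (i1 j).const_mul _,
    integral_finsetSum _ fun i _ => integrable_finsetSum _ fun j _ => (i2 i j).const_mul _]
  have s1 : ∑ j, ∫ ω, 2 * c k * W k j * ζ ω j ∂P = 0 :=
    Finset.sum_eq_zero fun j _ => by rw [integral_const_mul, h0, mul_zero]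
  have s2 : ∑ i, ∫ ω, ∑ j, W k i * W k j * (ζ ω i * ζ ω j) ∂P = (W * Γ * Wᵀ) k k := by
    simp only [mul_apply, transpose_apply, Finset.sum_mul]
    rw [Finset.sum_comm]
    refine Finset.sum_congr rfl fun i _ => ?_
    rw [integral_finsetSum _ fun j _ => (i2 i j).const_mul _]
    refine Finset.sum_congr rfl fun j _ => ?_
    rw [integral_const_mul, hΓ]
    ring
  rw [s1, s2]
  simp

/-! ### Innovations of a Gaussian process -/

theorem Idx.lt_of_fst_lt {N d : ℕ} {i j : Idx N d} (h : (ofLex i).1 < (ofLex j).1) : i < j :=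
  Prod.Lex.lt_iff.2 (Or.inl h)

theorem indep_comap_of_indep_map {Ω Ω' : Type*} {m₁ m₂ : MeasurableSpace Ω'}
    [mΩ : MeasurableSpace Ω] [mΩ' : MeasurableSpace Ω'] {ν : Measure Ω} {φ : Ω → Ω'}
    (hφ : Measurable φ) (h₁ : m₁ ≤ mΩ') (h₂ : m₂ ≤ mΩ')
    (h : Indep m₁ m₂ (ν.map φ)) : Indep (m₁.comap φ) (m₂.comap φ) ν := by
  rw [Indep_iff] at h ⊢
  rintro _ _ ⟨s, hs, rfl⟩ ⟨t, ht, rfl⟩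
  have := h s t hs ht
  rwa [Measure.map_apply hφ ((h₁ _ hs).inter (h₂ _ ht)), Measure.map_apply hφ (h₁ _ hs),
    Measure.map_apply hφ (h₂ _ ht), Set.preimage_inter] at this

theorem measurable_innovation {n : Type*} [Fintype n] (R : Matrix n n ℝ)
    (a : EuclideanSpace ℝ n) :
    Measurable fun x : EuclideanSpace ℝ n => WithLp.toLp 2 (R *ᵥ (x - a).ofLp) := by
  have h := (measurable_affine 0 R).comp (measurable_id.sub_const a)
  simpa [Function.comp_def] using h

/-- If `f` has the law of `a + L ε`, its innovations `R (f - a)` have the law of `R L ε`. In what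
follows `R L` is a diagonal matrix with entries in `{0, 1}`. -/
theorem map_innovation {Ω n : Type*} [Fintype n] [DecidableEq n] [MeasurableSpace Ω]
    {P : Measure Ω} {f : Ω → EuclideanSpace ℝ n} (hf : Measurable f) {a : EuclideanSpace ℝ n}
    {L R : Matrix n n ℝ}
    (hP : P.map f = (stdGaussian _).map
      fun ε : EuclideanSpace ℝ n => a + WithLp.toLp 2 (L *ᵥ ε.ofLp)) :
    P.map (fun ω => WithLp.toLp 2 (R *ᵥ (f ω - a).ofLp))
      = (stdGaussian (EuclideanSpace ℝ n)).map
        fun ε : EuclideanSpace ℝ n => WithLp.toLp 2 ((R * L) *ᵥ ε.ofLp) := by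
  have h := congrArg (Measure.map fun x => WithLp.toLp 2 (R *ᵥ (x - a).ofLp)) hP
  rw [Measure.map_map (measurable_innovation R a) hf,
    Measure.map_map (measurable_innovation R a) (measurable_affine a L)] at h
  simpa [Function.comp_def, mulVec_mulVec] using h

theorem integral_comp_innovation {Ω n : Type*} [Fintype n] [DecidableEq n] [MeasurableSpace Ω]
    {P : Measure Ω} {f : Ω → EuclideanSpace ℝ n} (hf : Measurable f) {a : EuclideanSpace ℝ n}
    {L R : Matrix n n ℝ}
    (hP : P.map f = (stdGaussian _).map
      fun ε : EuclideanSpace ℝ n => a + WithLp.toLp 2 (L *ᵥ ε.ofLp))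
    {G : EuclideanSpace ℝ n → ℝ} (hG : Measurable G) :
    ∫ ω, G (WithLp.toLp 2 (R *ᵥ (f ω - a).ofLp)) ∂P
      = ∫ ε, G (WithLp.toLp 2 ((R * L) *ᵥ ε.ofLp)) ∂stdGaussian (EuclideanSpace ℝ n) := by
  have h1 := integral_map ((measurable_innovation R a).comp hf).aemeasurable (μ := P)
    hG.aestronglyMeasurable
  have hm : Measurable fun ε : EuclideanSpace ℝ n => WithLp.toLp 2 ((R * L) *ᵥ ε.ofLp) := by
    simpa using measurable_affine (0 : EuclideanSpace ℝ n) (R * L)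
  have h2 := integral_map hm.aemeasurable (μ := stdGaussian (EuclideanSpace ℝ n))
    hG.aestronglyMeasurable
  refine h1.symm.trans (Eq.trans ?_ h2)
  rw [← map_innovation hf hP]
  rfl

theorem integral_innovation {Ω n : Type*} [Fintype n] [DecidableEq n] [MeasurableSpace Ω]
    {P : Measure Ω} {f : Ω → EuclideanSpace ℝ n} (hf : Measurable f) {a : EuclideanSpace ℝ n}
    {L R : Matrix n n ℝ} {δ : n → ℝ}
    (hP : P.map f = (stdGaussian _).map
      fun ε : EuclideanSpace ℝ n => a + WithLp.toLp 2 (L *ᵥ ε.ofLp))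
    (hRL : R * L = diagonal δ) (k : n) : ∫ ω, (R *ᵥ (f ω - a).ofLp) k ∂P = 0 := by
  have h := integral_comp_innovation (R := R) hf hP (G := fun x => x k) (by fun_prop)
  refine h.trans ?_
  simp only [hRL, mulVec_diagonal]
  rw [integral_const_mul, integral_coord_stdGaussian, mul_zero]

theorem integral_innovation_mul {Ω n : Type*} [Fintype n] [DecidableEq n] [MeasurableSpace Ω]
    {P : Measure Ω} {f : Ω → EuclideanSpace ℝ n} (hf : Measurable f) {a : EuclideanSpace ℝ n}
    {L R : Matrix n n ℝ} {δ : n → ℝ}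
    (hP : P.map f = (stdGaussian _).map
      fun ε : EuclideanSpace ℝ n => a + WithLp.toLp 2 (L *ᵥ ε.ofLp))
    (hRL : R * L = diagonal δ) (hδ : ∀ i, δ i = 0 ∨ δ i = 1) (k l : n) :
    ∫ ω, (R *ᵥ (f ω - a).ofLp) k * (R *ᵥ (f ω - a).ofLp) l ∂P = diagonal δ k l := by
  have h := integral_comp_innovation (R := R) hf hP (G := fun x => x k * x l) (by fun_prop)
  refine h.trans ?_
  simp only [hRL, mulVec_diagonal]
  have e : ∀ ε : EuclideanSpace ℝ n, δ k * ε k * (δ l * ε l) = δ k * δ l * (ε k * ε l) :=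
    fun ε => by ring
  simp only [e]
  rw [integral_const_mul, integral_coord_mul_stdGaussian, diagonal_apply, one_apply]
  by_cases hkl : k = l
  · subst hkl
    rcases hδ k with h | h <;> simp [h]
  · simp [hkl]

theorem memLp_innovation {Ω n : Type*} [Fintype n] [DecidableEq n] [MeasurableSpace Ω]
    {P : Measure Ω} {f : Ω → EuclideanSpace ℝ n} (hf : Measurable f) {a : EuclideanSpace ℝ n}
    {L R : Matrix n n ℝ} {δ : n → ℝ}
    (hP : P.map f = (stdGaussian _).map
      fun ε : EuclideanSpace ℝ n => a + WithLp.toLp 2 (L *ᵥ ε.ofLp))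
    (hRL : R * L = diagonal δ) (k : n) : MemLp (fun ω => (R *ᵥ (f ω - a).ofLp) k) 2 P := by
  have hk : Measurable fun x : EuclideanSpace ℝ n => x k := by fun_prop
  have hm : Measurable fun ε : EuclideanSpace ℝ n => WithLp.toLp 2 ((R * L) *ᵥ ε.ofLp) := by
    simpa using measurable_affine (0 : EuclideanSpace ℝ n) (R * L)
  have h2 : MemLp (fun x : EuclideanSpace ℝ n => x k) 2
      (P.map fun ω => WithLp.toLp 2 (R *ᵥ (f ω - a).ofLp)) := by
    rw [map_innovation hf hP, memLp_map_measure_iff hk.aestronglyMeasurable hm.aemeasurable]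
    have : (fun x : EuclideanSpace ℝ n => x k) ∘
        (fun ε : EuclideanSpace ℝ n => WithLp.toLp 2 ((R * L) *ᵥ ε.ofLp))
        = fun ε : EuclideanSpace ℝ n => δ k * ε k := by
      funext ε
      simp [hRL, mulVec_diagonal]
    rw [this]
    exact (memLp_coord_stdGaussian k).const_mul _
  exact (memLp_map_measure_iff hk.aestronglyMeasurable
    ((measurable_innovation R a).comp hf).aemeasurable).1 h2

theorem ae_eq_add_mulVec_innovation {Ω n : Type*} [Fintype n] [DecidableEq n] [MeasurableSpace Ω]
    {P : Measure Ω} {f : Ω → EuclideanSpace ℝ n} (hf : Measurable f) {a : EuclideanSpace ℝ n}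
    {L R : Matrix n n ℝ} {δ : n → ℝ}
    (hP : P.map f = (stdGaussian _).map
      fun ε : EuclideanSpace ℝ n => a + WithLp.toLp 2 (L *ᵥ ε.ofLp))
    (hRL : R * L = diagonal δ) (hLδ : L * diagonal δ = L) :
    ∀ᵐ ω ∂P, f ω = a + WithLp.toLp 2 (L *ᵥ (R *ᵥ (f ω - a).ofLp)) := by
  have hmeas : Measurable fun x : EuclideanSpace ℝ n =>
      a + WithLp.toLp 2 (L *ᵥ (R *ᵥ (x - a).ofLp)) := by
    have h := (measurable_affine a L).comp (measurable_innovation R a)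
    simpa only [Function.comp_def] using h
  have h : ∀ᵐ x ∂P.map f, x = a + WithLp.toLp 2 (L *ᵥ (R *ᵥ (x - a).ofLp)) := by
    rw [hP, ae_map_iff (measurable_affine a L).aemeasurable
      (measurableSet_eq_fun measurable_id' hmeas)]
    refine .of_forall fun ε => ?_
    simp only [add_sub_cancel_left, mulVec_mulVec, hRL, hLδ]
  exact ae_of_ae_map hf.aemeasurable h

/-- Innovations after time `t` are conditionally centred given the process up to time `t`. -/
theorem condExp_innovation_eq_zero {Ω : Type*} [MeasurableSpace Ω] {N d : ℕ} {P : Measure Ω}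
    [IsProbabilityMeasure P]
    {f : Ω → PathSpace N d} (hf : Measurable f) {a : PathSpace N d}
    {L R : Matrix (Idx N d) (Idx N d) ℝ} {δ : Idx N d → ℝ}
    (hP : P.map f = (stdGaussian _).map
      fun ε : PathSpace N d => a + WithLp.toLp 2 (L *ᵥ ε.ofLp))
    (hL : ∀ i j, (ofLex i).1 < (ofLex j).1 → L i j = 0) (hRL : R * L = diagonal δ)
    {t : Fin N} {k : Idx N d} (hk : t < (ofLex k).1) :
    P[fun ω => (R *ᵥ (f ω - a).ofLp) k | (pathFiltration N d t).comap f] =ᵐ[P] 0 := by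
  have hr : Measurable fun x : PathSpace N d => (R *ᵥ (x - a).ofLp) k :=
    (show Measurable fun x : PathSpace N d => x k by fun_prop).comp (measurable_innovation R a)
  have hind : Indep (MeasurableSpace.comap (fun x : PathSpace N d => (R *ᵥ (x - a).ofLp) k)
      inferInstance) (pathFiltration N d t) (P.map f) := by
    rw [hP]
    refine indep_map_of_indep_comap (measurable_affine a L) hr.comap_le
      ((pathFiltration N d).le t) ?_
    refine indep_of_indep_of_le_left (indep_of_indep_of_le_right
      (indep_coord_stdGaussian {k} {k : Idx N d | (ofLex k).1 ≤ t} ?_)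
      (comap_pathFiltration_linear_le a hL t)) ?_
    · simpa using hk
    · rw [MeasurableSpace.comap_comp, ← measurable_iff_comap_le]
      have : (fun x : PathSpace N d => (R *ᵥ (x - a).ofLp) k) ∘
          (fun ε : PathSpace N d => a + WithLp.toLp 2 (L *ᵥ ε.ofLp)) =
            fun ε : PathSpace N d => δ k * ε k := by
        funext ε
        simp [mulVec_mulVec, hRL, mulVec_diagonal]
      rw [this]
      exact (measurable_coord_comap {k} (Finset.mem_singleton_self k)).const_mul _
  have h := indep_comap_of_indep_map hf hr.comap_le ((pathFiltration N d).le t) hind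
  have hf' : (pathFiltration N d t).comap f ≤ _ :=
    (MeasurableSpace.comap_mono ((pathFiltration N d).le t)).trans hf.comap_le
  have hm₁ := (MeasurableSpace.comap_mono hr.comap_le).trans hf.comap_le
  refine (condExp_indep_eq hm₁ hf' (Measurable.stronglyMeasurable ?_) h).trans ?_
  · rw [MeasurableSpace.comap_comp]
    exact comap_measurable ((fun x : PathSpace N d => (R *ᵥ (x - a).ofLp) k) ∘ f)
  · rw [integral_innovation hf hP hRL]
    rfl

/-- The innovations of `f` after time `t` are uncorrelated with everything that `g` reveals up to
time `t`, as soon as `f` is causal with respect to `g`. -/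
theorem integral_innovation_mul_eq_zero {Ω : Type*} [mΩ : MeasurableSpace Ω] {N d : ℕ}
    {P : Measure Ω} [IsProbabilityMeasure P] {f g : Ω → PathSpace N d} (hf : Measurable f)
    (hg : Measurable g) {a : PathSpace N d}
    {L R : Matrix (Idx N d) (Idx N d) ℝ} {δ : Idx N d → ℝ}
    (hP : P.map f = (stdGaussian _).map
      fun ε : PathSpace N d => a + WithLp.toLp 2 (L *ᵥ ε.ofLp))
    (hL : ∀ i j, (ofLex i).1 < (ofLex j).1 → L i j = 0) (hRL : R * L = diagonal δ)
    {t : Fin N} {k : Idx N d} (hk : t < (ofLex k).1)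
    (hci : CondIndepGiven P ((⨆ s, pathFiltration N d s).comap f)
      ((pathFiltration N d t).comap g) ((pathFiltration N d t).comap f))
    {ψ : Ω → ℝ} (hψ : Measurable[(pathFiltration N d t).comap g] ψ) (hψ2 : MemLp ψ 2 P) :
    ∫ ω, (R *ᵥ (f ω - a).ofLp) k * ψ ω ∂P = 0 := by
  have hsup : (⨆ s, pathFiltration N d s) ≤ (inferInstance : MeasurableSpace (PathSpace N d)) :=
    iSup_le fun s => (pathFiltration N d).le s
  refine hci.integral_mul_eq_zero ((MeasurableSpace.comap_mono hsup).trans hf.comap_le)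
    ((MeasurableSpace.comap_mono ((pathFiltration N d).le t)).trans hg.comap_le)
    (MeasurableSpace.comap_mono (le_iSup (fun s => pathFiltration N d s) t)) ?_
    hψ.stronglyMeasurable (memLp_innovation hf hP hRL k) hψ2
    (condExp_innovation_eq_zero hf hP hL hRL hk)
  refine Measurable.stronglyMeasurable ?_
  refine measurable_mulVec_apply R (fun ω => (f ω - a).ofLp) k fun j _ => ?_
  have h1 : Measurable[⨆ s, pathFiltration N d s] fun x : PathSpace N d => x j :=
    (measurable_coord_pathFiltration le_rfl).mono
      (le_iSup (fun s => pathFiltration N d s) (ofLex j).1) le_rfl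
  exact (h1.comp (comap_measurable f)).sub_const (a j)

theorem measurable_innovation_pathFiltration {Ω : Type*} {N d : ℕ} (g : Ω → PathSpace N d)
    (a : PathSpace N d) {R : Matrix (Idx N d) (Idx N d) ℝ}
    (hR : ∀ i j, (ofLex i).1 < (ofLex j).1 → R i j = 0) (k : Idx N d) :
    Measurable[(pathFiltration N d (ofLex k).1).comap g]
      fun ω => (R *ᵥ (g ω - a).ofLp) k := by
  refine measurable_mulVec_apply R (fun ω => (g ω - a).ofLp) k fun j hj => ?_
  have hjk : (ofLex j).1 ≤ (ofLex k).1 := not_lt.1 fun h => hj (hR k j h)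
  exact ((measurable_coord_pathFiltration hjk).comp (comap_measurable g)).sub_const (a j)

/-! ### The lower bound on the cost of a bicausal coupling -/

theorem integral_sum_mul_sum_eq_dotProduct {Ω ι κ : Type*} [Fintype ι] [Fintype κ]
    [MeasurableSpace Ω] {P : Measure Ω} {ξ : ι → Ω → ℝ} {η : κ → Ω → ℝ}
    (hξ : ∀ i, MemLp (ξ i) 2 P) (hη : ∀ j, MemLp (η j) 2 P) (u : ι → ℝ) (v : κ → ℝ) :
    ∫ ω, (∑ i, u i * ξ i ω) * (∑ j, v j * η j ω) ∂P
      = u ⬝ᵥ (Matrix.of fun i j => ∫ ω, ξ i ω * η j ω ∂P) *ᵥ v := by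
  have e : ∀ ω, (∑ i, u i * ξ i ω) * (∑ j, v j * η j ω)
      = ∑ i, ∑ j, u i * v j * (ξ i ω * η j ω) := by
    intro ω
    rw [Finset.sum_mul_sum]
    exact Finset.sum_congr rfl fun i _ => Finset.sum_congr rfl fun j _ => by ring
  have i2 : ∀ i j, Integrable (fun ω => ξ i ω * η j ω) P := fun i j => (hξ i).integrable_mul (hη j)
  simp only [e]
  rw [integral_finsetSum _ fun i _ => integrable_finsetSum _ fun j _ => (i2 i j).const_mul _]
  simp only [dotProduct, mulVec, Finset.mul_sum, of_apply]
  refine Finset.sum_congr rfl fun i _ => ?_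
  rw [integral_finsetSum _ fun j _ => (i2 i j).const_mul _]
  refine Finset.sum_congr rfl fun j _ => ?_
  rw [integral_const_mul]
  ring

/-- The cross-covariance of two families of uncorrelated variables with variances at most one is
a contraction. -/
theorem dotProduct_crossCovariance_le_one {Ω ι : Type*} [Fintype ι] [DecidableEq ι]
    [MeasurableSpace Ω] {P : Measure Ω} {ξ η : ι → Ω → ℝ} {δ δ' : ι → ℝ}
    (hξ : ∀ i, MemLp (ξ i) 2 P) (hη : ∀ j, MemLp (η j) 2 P)
    (hξξ : ∀ i j, ∫ ω, ξ i ω * ξ j ω ∂P = diagonal δ i j)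
    (hηη : ∀ i j, ∫ ω, η i ω * η j ω ∂P = diagonal δ' i j)
    (hδ : ∀ i, δ i ≤ 1) (hδ' : ∀ i, δ' i ≤ 1) {u v : ι → ℝ} (hu : u ⬝ᵥ u = 1)
    (hv : v ⬝ᵥ v = 1) :
    u ⬝ᵥ (Matrix.of fun i j => ∫ ω, ξ i ω * η j ω ∂P) *ᵥ v ≤ 1 := by
  have hvar : ∀ (ξ : ι → Ω → ℝ) (δ : ι → ℝ) (u : ι → ℝ), (∀ i, MemLp (ξ i) 2 P) →
      (∀ i j, ∫ ω, ξ i ω * ξ j ω ∂P = diagonal δ i j) → (∀ i, δ i ≤ 1) → u ⬝ᵥ u = 1 →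
      ∫ ω, (∑ i, u i * ξ i ω) * (∑ i, u i * ξ i ω) ∂P ≤ 1 := by
    intro ξ δ u hξ hξξ hδ hu
    rw [integral_sum_mul_sum_eq_dotProduct hξ hξ, ← hu]
    have : (Matrix.of fun i j => ∫ ω, ξ i ω * ξ j ω ∂P) = diagonal δ := by
      ext i j
      exact hξξ i j
    rw [this]
    simp only [dotProduct, mulVec_diagonal]
    exact Finset.sum_le_sum fun i _ => by nlinarith [hδ i, mul_self_nonneg (u i)]
  have hlp : ∀ (ξ : ι → Ω → ℝ) (u : ι → ℝ), (∀ i, MemLp (ξ i) 2 P) →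
      MemLp (fun ω => ∑ i, u i * ξ i ω) 2 P := fun ξ u hξ =>
    memLp_finsetSum _ fun i _ => (hξ i).const_mul _
  rw [← integral_sum_mul_sum_eq_dotProduct hξ hη]
  have h1 := hvar ξ δ u hξ hξξ hδ hu
  have h2 := hvar η δ' v hη hηη hδ' hv
  have i1 := (hlp ξ u hξ).integrable_mul (hlp ξ u hξ)
  have i2 := (hlp η v hη).integrable_mul (hlp η v hη)
  have i3 := (hlp ξ u hξ).integrable_mul (hlp η v hη)
  have h3 := integral_mono (i3.const_mul 2) (i1.add i2) fun ω => by
    simp only [Pi.mul_apply, Pi.add_apply]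
    nlinarith [mul_self_nonneg ((∑ i, u i * ξ i ω) - ∑ j, v j * η j ω)]
  rw [integral_const_mul, integral_add' i1 i2] at h3
  simp only [Pi.mul_apply] at h3
  linarith

theorem trace_fromCols_mul_fromBlocks {n : Type*} [Fintype n] (L M D D' K : Matrix n n ℝ) :
    (fromCols L (-M) * fromBlocks D K Kᵀ D' * (fromCols L (-M))ᵀ).trace
      = (L * D * Lᵀ).trace + (M * D' * Mᵀ).trace - 2 * ((Lᵀ * M)ᵀ * K).trace := by
  have h1 : (M * Kᵀ * Lᵀ).trace = (L * K * Mᵀ).trace := by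
    rw [← trace_transpose]
    simp only [transpose_mul, transpose_transpose, mul_assoc]
  have h2 : ((Lᵀ * M)ᵀ * K).trace = (L * K * Mᵀ).trace := by
    rw [transpose_mul, transpose_transpose, mul_assoc, trace_mul_comm]
  rw [transpose_fromCols, fromCols_mul_fromBlocks, fromCols_mul_fromRows, h2]
  simp only [add_mul, transpose_neg, Matrix.mul_neg, Matrix.neg_mul, neg_neg, trace_add,
    trace_neg, h1]
  ring

/-- Every bicausal coupling of two Gaussian laws costs at least
`‖a - b‖² + ‖L‖² + ‖M‖² - 2 ∑ t, ‖(Lᵀ M)_{t,t}‖_*`. -/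
theorem le_lintegral_of_isBicausal {N d : ℕ} {a b : PathSpace N d}
    {A B L M : Matrix (Idx N d) (Idx N d) ℝ} (hA : A.PosSemidef) (hB : B.PosSemidef)
    (hL : IsMinCholesky A L) (hM : IsMinCholesky B M) {π : Measure (PathSpace N d × PathSpace N d)}
    (hπ : IsBicausal (canonical (multivariateGaussian a A)) (canonical (multivariateGaussian b B))
      π) :
    ENNReal.ofReal (∑ k, (a k - b k) ^ 2 + ((L * Lᵀ).trace + (M * Mᵀ).trace
      - 2 * ∑ t : Fin N, nuclearNorm (matBlock (Lᵀ * M) t t)))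
      ≤ ∫⁻ z, ∑ t, ‖block t z.1 - block t z.2‖ₑ ^ 2 ∂π := by
  obtain ⟨R, -, δ, hδ, -, hR, hRL, hLδ⟩ := hL.exists_lower_inverse
  obtain ⟨R', -, δ', hδ', -, hR', hRM, hMδ⟩ := hM.exists_lower_inverse
  have hP : π.map Prod.fst = (stdGaussian _).map
      fun ε : PathSpace N d => a + WithLp.toLp 2 (L *ᵥ ε.ofLp) :=
    hπ.map_fst.trans (map_stdGaussian_eq_multivariateGaussian a hA hL.mul_transpose).symm
  have hQ : π.map Prod.snd = (stdGaussian _).map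
      fun ε : PathSpace N d => b + WithLp.toLp 2 (M *ᵥ ε.ofLp) :=
    hπ.map_snd.trans (map_stdGaussian_eq_multivariateGaussian b hB hM.mul_transpose).symm
  have : IsProbabilityMeasure π := by
    have h : IsProbabilityMeasure (π.map Prod.fst) := by
      rw [hP]
      exact Measure.isProbabilityMeasure_map (measurable_affine a L).aemeasurable
    exact Measure.isProbabilityMeasure_of_map (μ := π) Prod.fst
  let ξ : Idx N d → PathSpace N d × PathSpace N d → ℝ := fun k z => (R *ᵥ (z.1 - a).ofLp) k
  let η : Idx N d → PathSpace N d × PathSpace N d → ℝ := fun k z => (R' *ᵥ (z.2 - b).ofLp) k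
  have hξ2 : ∀ k, MemLp (ξ k) 2 π := memLp_innovation measurable_fst hP hRL
  have hη2 : ∀ k, MemLp (η k) 2 π := memLp_innovation measurable_snd hQ hRM
  have hξξ : ∀ k l, ∫ z, ξ k z * ξ l z ∂π = diagonal δ k l :=
    integral_innovation_mul measurable_fst hP hRL hδ
  have hηη : ∀ k l, ∫ z, η k z * η l z ∂π = diagonal δ' k l :=
    integral_innovation_mul measurable_snd hQ hRM hδ'
  let K : Matrix (Idx N d) (Idx N d) ℝ := Matrix.of fun k l => ∫ z, ξ k z * η l z ∂π
  have hK : ∀ k l, (ofLex k).1 ≠ (ofLex l).1 → K k l = 0 := by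
    intro k l hkl
    rcases lt_or_gt_of_ne hkl with h | h
    · have hci := hπ.anticausal (ofLex k).1
      simp only [MeasurableSpace.prod, MeasurableSpace.comap_bot, bot_sup_eq, sup_bot_eq] at hci
      have := integral_innovation_mul_eq_zero measurable_snd measurable_fst hQ
        (fun i j hij => hM.lower i j (Idx.lt_of_fst_lt hij)) hRM h hci
        (measurable_innovation_pathFiltration Prod.fst a
          (fun i j hij => hR i j (Idx.lt_of_fst_lt hij)) k) (hξ2 k)
      refine Eq.trans (integral_congr_ae (.of_forall fun z => ?_)) this
      exact mul_comm _ _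
    · have hci := hπ.causal (ofLex l).1
      simp only [MeasurableSpace.prod, MeasurableSpace.comap_bot, bot_sup_eq, sup_bot_eq] at hci
      exact integral_innovation_mul_eq_zero measurable_fst measurable_snd hP
        (fun i j hij => hL.lower i j (Idx.lt_of_fst_lt hij)) hRL h hci
        (measurable_innovation_pathFiltration Prod.snd b
          (fun i j hij => hR' i j (Idx.lt_of_fst_lt hij)) l) (hη2 l)
  have hKle : ((Lᵀ * M)ᵀ * K).trace ≤ ∑ t : Fin N, nuclearNorm (matBlock (Lᵀ * M) t t) := by
    rw [trace_transpose_mul_eq_sum_matBlock _ _ hK]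
    refine Finset.sum_le_sum fun t _ => trace_transpose_mul_le_nuclearNorm _ _ fun u v hu hv => ?_
    have hle : ∀ δ : Idx N d → ℝ, (∀ i, δ i = 0 ∨ δ i = 1) → ∀ i : Fin d,
        δ (toLex (t, i)) ≤ 1 := by
      intro δ hδ i
      rcases hδ (toLex (t, i)) with h | h <;> simp [h]
    refine dotProduct_crossCovariance_le_one (P := π) (ξ := fun i => ξ (toLex (t, i)))
      (η := fun i => η (toLex (t, i))) (fun i => hξ2 _) (fun i => hη2 _)
      (δ := fun i => δ (toLex (t, i))) (δ' := fun i => δ' (toLex (t, i)))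
      (fun i j => ?_) (fun i j => ?_) (hle δ hδ) (hle δ' hδ') hu hv
    · rw [hξξ]; simp [diagonal_apply]
    · rw [hηη]; simp [diagonal_apply]
  -- the cost only depends on the joint covariance matrix of the two families of innovations
  have hcost : ∫⁻ z, ∑ t, ‖block t z.1 - block t z.2‖ₑ ^ 2 ∂π
      = ENNReal.ofReal (∑ k, (a k - b k) ^ 2 + (fromCols L (-M) *
        fromBlocks (diagonal δ) K Kᵀ (diagonal δ') * (fromCols L (-M))ᵀ).trace) := by
    rw [← lintegral_sum_sq_const_add_mulVec (P := π) (fun k => a k - b k) (fromCols L (-M))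
      (fun z => Sum.elim (fun k => ξ k z) fun k => η k z)]
    · refine lintegral_congr_ae ?_
      filter_upwards [ae_eq_add_mulVec_innovation measurable_fst hP hRL hLδ,
        ae_eq_add_mulVec_innovation measurable_snd hQ hRM hMδ] with z h1 h2
      rw [sum_enorm_block_sub_sq]
      congr 1
      refine Finset.sum_congr rfl fun k _ => ?_
      have e1 : z.1 k = a k + (L *ᵥ fun j => ξ j z) k := congrArg (fun x : PathSpace N d => x k) h1
      have e2 : z.2 k = b k + (M *ᵥ fun j => η j z) k := congrArg (fun x : PathSpace N d => x k) h2
      rw [fromCols_mulVec]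
      simp only [e1, e2, Pi.add_apply, neg_mulVec, Pi.neg_apply, Sum.elim_comp_inl,
        Sum.elim_comp_inr]
      ring
    · rintro (k | k)
      exacts [hξ2 k, hη2 k]
    · rintro (k | k)
      exacts [integral_innovation measurable_fst hP hRL k,
        integral_innovation measurable_snd hQ hRM k]
    · rintro (k | k) (l | l)
      · exact hξξ k l
      · rfl
      · exact integral_congr_ae (.of_forall fun z => mul_comm _ _)
      · exact hηη k l
  rw [hcost, trace_fromCols_mul_fromBlocks, hLδ, hMδ]
  exact ENNReal.ofReal_le_ofReal (by linarith)

/-! ### The optimal coupling -/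

/-- The block diagonal matrix with the given temporal blocks. -/
def ofDiagBlocks {N d : ℕ} (Q : Fin N → Matrix (Fin d) (Fin d) ℝ) :
    Matrix (Idx N d) (Idx N d) ℝ :=
  (blockDiagonal Q).submatrix (ofLex.trans (Equiv.prodComm _ _))
    (ofLex.trans (Equiv.prodComm _ _))

theorem ofDiagBlocks_apply {N d : ℕ} (Q : Fin N → Matrix (Fin d) (Fin d) ℝ) (k l : Idx N d) :
    ofDiagBlocks Q k l
      = if (ofLex k).1 = (ofLex l).1 then Q (ofLex k).1 (ofLex k).2 (ofLex l).2 else 0 :=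
  rfl

theorem ofDiagBlocks_transpose_mul_self {N d : ℕ} {Q : Fin N → Matrix (Fin d) (Fin d) ℝ}
    (hQ : ∀ t, (Q t)ᵀ * Q t = 1) : (ofDiagBlocks Q)ᵀ * ofDiagBlocks Q = 1 := by
  have h : (blockDiagonal Q)ᵀ * blockDiagonal Q = 1 := by
    rw [blockDiagonal_transpose, ← blockDiagonal_mul]
    simp only [hQ]
    exact blockDiagonal_one
  rw [ofDiagBlocks, transpose_submatrix, submatrix_mul_equiv, h, submatrix_one_equiv]

theorem measurable_sum_sub_sq {N d : ℕ} : Measurable fun z : PathSpace N d × PathSpace N d =>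
    ENNReal.ofReal (∑ k, (z.1 k - z.2 k) ^ 2) := by
  fun_prop

theorem lintegral_map_sum_enorm_block_sub {Ω : Type*} [MeasurableSpace Ω] {N d : ℕ}
    {P : Measure Ω} {f g : Ω → PathSpace N d} (hf : Measurable f) (hg : Measurable g) :
    ∫⁻ z, ∑ t, ‖block t z.1 - block t z.2‖ₑ ^ 2 ∂P.map (fun ω => (f ω, g ω))
      = ∫⁻ ω, ENNReal.ofReal (∑ k, (f ω k - g ω k) ^ 2) ∂P := by
  simp only [sum_enorm_block_sub_sq]
  exact lintegral_map measurable_sum_sub_sq (hf.prodMk hg)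

/-- The lower bound on the cost is attained, by `a + L ε` and `b + M Uᵀ ε` where the diagonal blocks
of the block diagonal matrix `U` are orthogonal and optimal for the nuclear norms. In particular the
variance part of the bound is nonnegative. -/
theorem exists_isBicausal_lintegral_eq {N d : ℕ} (a b : PathSpace N d)
    {A B L M : Matrix (Idx N d) (Idx N d) ℝ} (hA : A.PosSemidef) (hB : B.PosSemidef)
    (hL : IsMinCholesky A L) (hM : IsMinCholesky B M) :
    0 ≤ (L * Lᵀ).trace + (M * Mᵀ).trace
      - 2 * ∑ t : Fin N, nuclearNorm (matBlock (Lᵀ * M) t t) ∧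
    ∃ π : Measure (PathSpace N d × PathSpace N d),
      IsBicausal (canonical (multivariateGaussian a A)) (canonical (multivariateGaussian b B)) π ∧
      ∫⁻ z, ∑ t, ‖block t z.1 - block t z.2‖ₑ ^ 2 ∂π =
        ENNReal.ofReal (∑ k, (a k - b k) ^ 2 + ((L * Lᵀ).trace + (M * Mᵀ).trace
          - 2 * ∑ t : Fin N, nuclearNorm (matBlock (Lᵀ * M) t t))) := by
  obtain ⟨R, S, δ, -, hSR, hR, hRL, -⟩ := hL.exists_lower_inverse
  obtain ⟨R', S', δ', -, hSR', hR', hRM, -⟩ := hM.exists_lower_inverse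
  choose Q hQ hQtr using fun t : Fin N =>
    exists_orthogonal_trace_eq_nuclearNorm (matBlock (Lᵀ * M) t t)
  have hU0 : ∀ k l, (ofLex k).1 ≠ (ofLex l).1 → ofDiagBlocks Q k l = 0 := fun k l h => by
    rw [ofDiagBlocks_apply, if_neg h]
  have hUU := ofDiagBlocks_transpose_mul_self hQ
  have hUblock : ∀ t, matBlock (ofDiagBlocks Q) t t = Q t := fun t => by
    ext i j
    simp [matBlock, ofDiagBlocks_apply]
  set U := ofDiagBlocks Q
  have htr : ((Lᵀ * M)ᵀ * U).trace = ∑ t : Fin N, nuclearNorm (matBlock (Lᵀ * M) t t) := by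
    rw [trace_transpose_mul_eq_sum_matBlock _ _ hU0]
    simp only [hUblock, hQtr]
  have hMU : (M * Uᵀ) * (M * Uᵀ)ᵀ = M * Mᵀ := by
    rw [transpose_mul, transpose_transpose, mul_assoc, ← mul_assoc Uᵀ, hUU, one_mul]
  have hW : ((L - M * Uᵀ) * (L - M * Uᵀ)ᵀ).trace = (L * Lᵀ).trace + (M * Mᵀ).trace
      - 2 * ∑ t : Fin N, nuclearNorm (matBlock (Lᵀ * M) t t) := by
    have h1 : (M * Uᵀ * Lᵀ).trace = (L * (M * Uᵀ)ᵀ).trace := by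
      rw [← trace_transpose]
      simp only [transpose_mul, transpose_transpose]
    have h2 : ((Lᵀ * M)ᵀ * U).trace = (L * (M * Uᵀ)ᵀ).trace := by
      simp only [transpose_mul, transpose_transpose]
      rw [mul_assoc, trace_mul_comm, mul_assoc]
    rw [← htr, h2, transpose_sub, sub_mul, mul_sub, mul_sub, hMU]
    simp only [trace_sub, h1]
    ring
  refine ⟨?_, _, isBicausal_canonical_of_linear (a := a) (b := b) (L := L) (M := M * Uᵀ)
    (R := R) (K := S) (R' := R') (K' := S')
    (map_stdGaussian_eq_multivariateGaussian a hA hL.mul_transpose)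
    (map_stdGaussian_eq_multivariateGaussian b hB (hMU.trans hM.mul_transpose))
    (fun i j hij => hL.lower i j (Idx.lt_of_fst_lt hij)) (fun i j hij => ?_)
    (fun i j hij => hR i j (Idx.lt_of_fst_lt hij)) hSR (fun i j hij => ?_)
    (fun i j hij => hR' i j (Idx.lt_of_fst_lt hij)) hSR' (fun i j hij => ?_), ?_⟩
  · rw [← hW, trace]
    exact Finset.sum_nonneg fun i _ => Finset.sum_nonneg fun j _ => mul_self_nonneg _
  · rw [mul_apply]
    refine Finset.sum_eq_zero fun k _ => ?_
    by_cases hk : (ofLex j).1 = (ofLex k).1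
    · rw [hM.lower i k (Idx.lt_of_fst_lt (hk ▸ hij)), zero_mul]
    · rw [transpose_apply, hU0 j k hk, mul_zero]
  · rw [hRL, diagonal_apply_ne _ (Idx.lt_of_fst_lt hij).ne']
  · rw [← mul_assoc, hRM, diagonal_mul, transpose_apply, hU0 j i hij.ne, mul_zero]
  · rw [← hW]
    have h := lintegral_sum_sq_const_add_mulVec (P := stdGaussian (PathSpace N d))
      (fun k => a k - b k) (L - M * Uᵀ) (fun ε => ε.ofLp) 1 memLp_coord_stdGaussian
      integral_coord_stdGaussian integral_coord_mul_stdGaussian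
    rw [mul_one] at h
    rw [← h]
    refine (lintegral_map_sum_enorm_block_sub (measurable_affine a L)
      (measurable_affine b (M * Uᵀ))).trans (lintegral_congr fun ε => ?_)
    congr 1
    refine Finset.sum_congr rfl fun k _ => ?_
    simp only [sub_mulVec, Pi.sub_apply, PiLp.add_apply]
    ring

/-! ### The adapted Wasserstein distance between Gaussian laws -/

/-- Unfolding of `AW2Law` in which the sample spaces of the canonical processes appear as
`PathSpace N d`. -/
theorem AW2Law_eq_iInf {N d : ℕ} (μ ν : Measure (PathSpace N d)) [IsProbabilityMeasure μ]
    [IsProbabilityMeasure ν] : AW2Law μ ν =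
      ⨅ (π : Measure (PathSpace N d × PathSpace N d))
        (_ : IsBicausal (canonical μ) (canonical ν) π),
        (∫⁻ z, ∑ t, ‖block t z.1 - block t z.2‖ₑ ^ 2 ∂π) ^ (1 / 2 : ℝ) := rfl

theorem AW2_gaussianProcess_le {N d : ℕ} {a : PathSpace N d}
    {L : Matrix (Idx N d) (Idx N d) ℝ} {hL : IsBlockLower L} {μ : Measure (PathSpace N d)}
    [IsProbabilityMeasure μ] {π : Measure (PathSpace N d × PathSpace N d)}
    (hπ : IsBicausal (gaussianProcess a L hL) (canonical μ) π) :
    AW2 (gaussianProcess a L hL) (canonical μ) ≤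
      (∫⁻ z, ∑ t, ‖block t (a + WithLp.toLp 2 (L *ᵥ z.1.ofLp)) - block t z.2‖ₑ ^ 2 ∂π)
        ^ (1 / 2 : ℝ) :=
  iInf₂_le π hπ

theorem AW2_gaussianProcess_canonical {N d : ℕ} (a : PathSpace N d)
    {A : Matrix (Idx N d) (Idx N d) ℝ} (hA : A.PosSemidef) :
    AW2 (gaussianProcess a (minCholesky A hA) (isBlockLower_minCholesky hA))
        (canonical (multivariateGaussian a A)) = 0 := by
  have hL := isMinCholesky_minCholesky hA
  obtain ⟨R, K, δ, -, hKR, hR, hRL, -⟩ := hL.exists_lower_inverse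
  have hone : ∀ i j : Idx N d, (ofLex i).1 ≠ (ofLex j).1 →
      (1 : Matrix (Idx N d) (Idx N d) ℝ) i j = 0 := fun i j hij =>
    one_apply_ne fun h => hij (by rw [h])
  -- the noise is the process with factor `1`, coupled with `a + L ε` through the same noise
  have hπ := isBicausal_canonical_of_linear (a := 0) (b := a) (L := 1) (M := minCholesky A hA)
    (R := 1) (K := 1) (R' := R) (K' := K)
    (map_stdGaussian_eq_multivariateGaussian (0 : PathSpace N d) PosSemidef.one (by simp))
    (map_stdGaussian_eq_multivariateGaussian a hA hL.mul_transpose)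
    (fun i j hij => hone i j hij.ne) (fun i j hij => hL.lower i j (Idx.lt_of_fst_lt hij))
    (fun i j hij => hone i j hij.ne) (one_mul 1)
    (fun i j hij => by rw [one_mul, hone i j hij.ne'])
    (fun i j hij => hR i j (Idx.lt_of_fst_lt hij)) hKR
    (fun i j hij => by rw [hRL, diagonal_apply_ne _ (Idx.lt_of_fst_lt hij).ne'])
  have hπ' : IsBicausal (gaussianProcess a (minCholesky A hA) (isBlockLower_minCholesky hA))
      (canonical (multivariateGaussian a A)) _ :=
    ⟨hπ.map_fst.trans multivariateGaussian_zero_one, hπ.map_snd, hπ.causal, hπ.anticausal⟩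
  refine le_antisymm ((AW2_gaussianProcess_le hπ').trans ?_) zero_le
  have hm := measurable_affine a (minCholesky A hA)
  have h0 : ∫⁻ z : PathSpace N d × PathSpace N d, ENNReal.ofReal (∑ k,
      ((a + WithLp.toLp 2 (minCholesky A hA *ᵥ z.1.ofLp)) k - z.2 k) ^ 2)
      ∂(stdGaussian (PathSpace N d)).map (fun ε =>
        ((0 : PathSpace N d) + WithLp.toLp 2 ((1 : Matrix _ _ ℝ) *ᵥ ε.ofLp),
        a + WithLp.toLp 2 (minCholesky A hA *ᵥ ε.ofLp))) = 0 := by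
    refine (lintegral_map (measurable_sum_sub_sq.comp
      ((hm.comp measurable_fst).prodMk measurable_snd))
      ((measurable_affine (0 : PathSpace N d) 1).prodMk hm)).trans ?_
    simp
  simp only [sum_enorm_block_sub_sq]
  exact le_of_eq ((congrArg (fun c : ℝ≥0∞ => c ^ (1 / 2 : ℝ)) h0).trans
    (ENNReal.zero_rpow_of_pos (by norm_num)))

theorem AW2Law_multivariateGaussian_sq {N d : ℕ} (a b : PathSpace N d)
    {A B : Matrix (Idx N d) (Idx N d) ℝ} (hA : A.PosSemidef) (hB : B.PosSemidef) :
    AW2Law (multivariateGaussian a A) (multivariateGaussian b B) ^ 2 = ENNReal.ofReal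
      (‖a - b‖ ^ 2 + distAW (minCholesky A hA) (minCholesky B hB) ^ 2) := by
  have hL := isMinCholesky_minCholesky hA
  have hM := isMinCholesky_minCholesky hB
  obtain ⟨h0, π, hπ, hcost⟩ := exists_isBicausal_lintegral_eq a b hA hB hL hM
  have hnorm : ‖a - b‖ ^ 2 = ∑ k, (a k - b k) ^ 2 := by
    simp [EuclideanSpace.real_norm_sq_eq]
  rw [distAW_sq _ _ h0, hnorm, AW2Law_eq_iInf]
  have hAW := le_antisymm
    ((iInf₂_le π hπ).trans_eq (congrArg (fun c : ℝ≥0∞ => c ^ (1 / 2 : ℝ)) hcost))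
    (le_iInf₂ fun π' hπ' => ENNReal.rpow_le_rpow (z := 1 / 2)
      (le_lintegral_of_isBicausal hA hB hL hM hπ') (by norm_num))
  rw [hAW, ← ENNReal.rpow_natCast, ← ENNReal.rpow_mul]
  norm_num

theorem theorem3p10 (N d : ℕ) :
    (∀ (a : PathSpace N d) (A : Matrix (Idx N d) (Idx N d) ℝ) (hA : A.PosSemidef),
      AW2 (gaussianProcess a (minCholesky A hA) (isBlockLower_minCholesky hA))
        (canonical (multivariateGaussian a A)) = 0) ∧
    (∀ (a b : PathSpace N d) (A B : Matrix (Idx N d) (Idx N d) ℝ)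
        (hA : A.PosSemidef) (hB : B.PosSemidef),
      AW2Law (multivariateGaussian a A) (multivariateGaussian b B) ^ 2 =
        ENNReal.ofReal
          (‖a - b‖ ^ 2 + distAW (minCholesky A hA) (minCholesky B hB) ^ 2)) := by
  exact ⟨fun a _ hA => AW2_gaussianProcess_canonical a hA,
    fun a b _ _ hA hB => AW2Law_multivariateGaussian_sq a b hA hB⟩
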